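/- **Setting.** Consider a finite-horizon MDP with a state space $\mathcal X$, a finite nonempty action set $\mathcal Y$ with $A=|\mathcal Y|$, horizon $H$, deterministic transitions $x_{h+1}=P_h(x_h,y_h)$, deterministic rewards $r_h:\mathcal X\times\mathcal Y\to\mathbb R$, an initial state $x_1$ drawn from a discrete distribution (in particular, possibly fixed), and a reference policy $\pi^{\mathrm{ref}}=(\pi^{\mathrm{ref}}_h)_{h\le H}$. For $\eta>0$ the KL-regularized value of a policy $\pi$ is $$V^{\pi,\eta}=\mathbb E_\pi\Big[\sum_{h=1}^H r_h(x_h,y_h)-\eta\,\mathrm{KL}\big(\pi_h(x_h)\,\|\,\pi^{\mathrm{ref}}_h(x_h)\big)\Big].$$ The optimal value is given by the soft Bellman equations $V^{\star,\eta}_{H+1}=0$, $Q^{\star,\eta}_h(x,y)=r_h(x,y)+V^{\star,\eta}_{h+1}(P_h(x,y))$, $V^{\star,\eta}_h(x)=\eta\ln\mathbb E_{y\sim\pi^{\mathrm{ref}}_h(x)}\exp(Q^{\star,\eta}_h(x,y)/\eta)$, and $V^{\star,\eta}=\mathbb E[V^{\star,\eta}_1(x_1)]$. Let $Z^\star_h(x,y)$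 be the law of $\sum_{t\ge h}r_t(x_t,y_t)$ under $\pi^{\mathrm{ref}}$ given $x_h=x$, $y_h=y$. For $Z=(Z_h)$ with $Z_h(x,y)$ a discrete distribution on $[0,1]$, let $\pi^{Z,\eta}_h(y\mid x)\propto\pi^{\mathrm{ref}}_h(y\mid x)\,\mathbb E_{z\sim Z_h(x,y)}[e^{z/\eta}]$. **Algorithm.** Let $\mathcal F$ be a class of such $Z$ with $Z^\star\in\mathcal F$. In iteration $k=1,\dots,K$, an online oracle, given the data of the iterations before $k$ and possibly using its own randomness (of discrete law), outputs $\widehat Z_k\in\mathcal F$ (for $k=1$ a random initialization); put $\pi^k=\pi^{\widehat Z_k,\eta}$. For each $h\in[H]$, independently, one rolls in with $\pi^k$ to $x_{h,k}$, plays $y_{h,k}\sim\mathrm{Unif}(\mathcal Y)$, follows $\pi^{\mathrm{ref}}$ to the end, and records $R_{h,k}=\sum_{t\ge h}r_t$. The oracle has maximum-likelihood regret at most $\mathrm{Reg}_{\mathrm{mle}}(K)$: for any data (with $Z^\star_h(R_{h,k}\mid x_{h,k},y_{h,k})>0$) and any corresponding outputs, $$\sum_{k=1}^K\sum_{h=1}^H\big(\log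 Z^\star_h(R_{h,k}\mid x_{h,k},y_{h,k})-\log\widehat Z_{h,k}(R_{h,k}\mid x_{h,k},y_{h,k})\big)\le\mathrm{Reg}_{\mathrm{mle}}(K),$$ where in particular the likelihoods $\widehat Z_{h,k}(R_{h,k}\mid x_{h,k},y_{h,k})$ are positive. **Claim.** There is a universal constant $C$ such that the following holds. Suppose that the rewards-to-go are Bernoulli, $Z^\star_h(x,y)=\mathrm{Ber}(p_h(x,y))$ for all $h\in[H]$, $x$, $y$. Let $\eta\in(0,1]$, $\delta\in(0,1)$ and $\beta=\ln(1/\delta)+\mathrm{Reg}_{\mathrm{mle}}(K)$. Then with probability at least $1-\delta$ $$\sum_{k=1}^K\big(V^{\star,\eta}-V^{\pi^k,\eta}\big)\le C A\Big(\sqrt{\sum_{h=1}^H\sum_{k=1}^K\mathbb E_{x_h\sim\pi^k,\,y_h\sim\mathrm{Unif}(\mathcal Y)}\big[\mathrm{CV}_h(x_h,y_h)^2\big]\,\beta}+\max_{h\in[H]}E_h\,\beta\Big)$$ $$\le C A\Big(\sqrt{\sum_{h=1}^H\sum_{k=1}^K\mathbb E_{x_h\sim\pi^k,\,y_h\sim\mathrm{Unif}(\mathcal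 Y)}\Big[\frac{1-p_h(x_h,y_h)}{p_h(x_h,y_h)}\Big]\,\beta}+\max_{h\in[H]}\Big\|\frac1{p_h(x_h,y_h)}\Big\|_{L_\infty(\pi^{\mathrm{ref}})}\beta\Big),$$ where $\mathrm{CV}_h(x,y)=\sqrt{\mathrm{Var}(e^{Z^\star_h(x,y)/\eta})}\,/\,\mathbb E[e^{Z^\star_h(x,y)/\eta}]$, $E_h=\|\exp((1-Q^{\star,\eta}_h(x_h,y_h))/\eta)\|_{L_\infty(\pi^{\mathrm{ref}})}$, and $1/0=\infty$. The last expression contains no factor that is exponential in $1/\eta$. -/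

import Mathlib

open scoped ENNReal NNReal

noncomputable section

namespace QSharp

/-- Expectation of a real function under a discrete distribution. -/
def expect {α : Type*} (μ : PMF α) (f : α → ℝ) : ℝ := ∑' a, (μ a).toReal * f a

/-- Variance of a real function under a discrete distribution. -/
def variance {α : Type*} (μ : PMF α) (f : α → ℝ) : ℝ :=
  expect μ fun a => (f a - expect μ f) ^ 2

/-- Expectation of a `[0, ∞]`-valued function under a discrete distribution. -/
def eexpect {α : Type*} (μ : PMF α) (f : α → ℝ≥0∞) : ℝ≥0∞ := ∑' a, μ a * f a

/-- The `L_∞(μ)` norm of a `[0, ∞]`-valued function: the essential supremum with respect to a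
discrete distribution is the supremum over its support. -/
def linfNorm {α : Type*} (μ : PMF α) (f : α → ℝ≥0∞) : ℝ≥0∞ := ⨆ a ∈ μ.support, f a

/-- Kullback-Leibler divergence of two distributions on a finite set. It is used only when
`p` is absolutely continuous with respect to `q`, where it is finite. -/
def kl {Y : Type*} [Fintype Y] (p q : PMF Y) : ℝ :=
  ∑ y, (p y).toReal * Real.log ((p y).toReal / (q y).toReal)

/-- The joint law of independent samples from `p 0, …, p (n - 1)`. -/
def indepLaw {D : Type*} (p : ℕ → PMF D) : (n : ℕ) → PMF (Fin n → D)
  | 0 => PMF.pure Fin.elim0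
  | n + 1 => (indepLaw p n).bind fun d => (p n).map fun a => Fin.snoc (α := fun _ => D) d a

/-- A policy: a distribution over actions for every step and state. -/
abbrev Policy (X Y : Type*) := ℕ → X → PMF Y

/-- A model `f = (f_h)` of the reward-to-go, with `f_h(x, y)` a distribution on `[0, 1]`. -/
abbrev Model (X Y : Type*) := ℕ → X → Y → PMF unitInterval

/-- The likelihood `f_h(R ∣ x, y)` that a model gives to a real number `R`. -/
def likelihood {X Y : Type*} (f : Model X Y) (h : ℕ) (x : X) (y : Y) (R : ℝ) : ℝ :=
  ((f h x y).map (Subtype.val : unitInterval → ℝ) R).toReal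

/-- A finite-horizon MDP with deterministic transitions and rewards, together with a reference
policy. Steps are numbered `0, …, H - 1`; the values of the fields at steps `h ≥ H` are
never used. -/
structure DetMDP (X Y : Type*) where
  /-- horizon -/
  H : ℕ
  /-- distribution of the initial state -/
  init : PMF X
  /-- transition function -/
  step : ℕ → X → Y → X
  /-- reward function -/
  reward : ℕ → X → Y → ℝ
  /-- reference policy -/
  ref : Policy X Y

namespace DetMDP

variable {X Y : Type*} (M : DetMDP X Y)

/-- The law of the state `x_h` when the policy `π` is played. -/
def stateLaw (π : Policy X Y) : ℕ → PMF X
  | 0 => M.init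
  | h + 1 => (stateLaw π h).bind fun x => (π h x).map (M.step h x)

/-- The law of `(x_h, y_h)` when the policy `π` is played. -/
def stateActionLaw (π : Policy X Y) (h : ℕ) : PMF (X × Y) :=
  (M.stateLaw π h).bind fun x => (π h x).map fun y => (x, y)

/-- The law of `(x_h, y_h)` when `x_h` is reached by `π` and `y_h` is a uniformly random action. -/
def rollInUnifLaw [Fintype Y] [Nonempty Y] (π : Policy X Y) (h : ℕ) : PMF (X × Y) :=
  (M.stateLaw π h).bind fun x => (PMF.uniformOfFintype Y).map fun y => (x, y)

/-- The law of `∑_{t ≥ h} r_t(x_t, y_t)` under the reference policy started from `x_h = x`. -/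
def refReturn (h : ℕ) (x : X) : PMF ℝ :=
  if h < M.H then
    (M.ref h x).bind fun y =>
      (refReturn (h + 1) (M.step h x y)).map fun z => M.reward h x y + z
  else PMF.pure 0
termination_by M.H - h

/-- The reward-to-go distribution `Z⋆_h(x, y)`: the law of `∑_{t ≥ h} r_t(x_t, y_t)` under the
reference policy, given `x_h = x` and `y_h = y`. -/
def Zstar (h : ℕ) (x : X) (y : Y) : PMF ℝ :=
  (M.refReturn (h + 1) (M.step h x y)).map fun z => M.reward h x y + z

/-- The optimal KL-regularized value function, by the soft Bellman equations. -/
def softV [Fintype Y] (η : ℝ) (h : ℕ) (x : X) : ℝ :=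
  if h < M.H then
    η * Real.log (∑ y, (M.ref h x y).toReal *
      Real.exp ((M.reward h x y + softV η (h + 1) (M.step h x y)) / η))
  else 0
termination_by M.H - h

/-- The optimal KL-regularized action-value function. -/
def softQ [Fintype Y] (η : ℝ) (h : ℕ) (x : X) (y : Y) : ℝ :=
  M.reward h x y + M.softV η (h + 1) (M.step h x y)

/-- The optimal KL-regularized value `V^{⋆,η}`. -/
def optValue [Fintype Y] (η : ℝ) : ℝ := expect M.init (M.softV η 0)

/-- The KL-regularized value `V^{π,η}` of a policy. -/
def value [Fintype Y] (η : ℝ) (π : Policy X Y) : ℝ :=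
  ∑ h ∈ Finset.range M.H, expect (M.stateActionLaw π h) fun xy =>
    M.reward h xy.1 xy.2 - η * kl (π h xy.1) (M.ref h xy.1)

/-- The unnormalized weight `π^ref_h(y ∣ x) · E_{z ∼ Z_h(x,y)} exp(z / η)`. -/
def tiltWeight (η : ℝ) (Z : Model X Y) (h : ℕ) (x : X) (y : Y) : ℝ≥0∞ :=
  M.ref h x y * eexpect (Z h x y) fun z => ENNReal.ofReal (Real.exp ((z : ℝ) / η))

theorem tsum_tiltWeight_ne_zero (η : ℝ) (Z : Model X Y) (h : ℕ) (x : X) :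
    ∑' y, M.tiltWeight η Z h x y ≠ 0 := by
  obtain ⟨y, hy⟩ := (M.ref h x).support_nonempty
  obtain ⟨z, hz⟩ := (Z h x y).support_nonempty
  intro h0
  have h1 := ENNReal.tsum_eq_zero.1 h0 y
  rcases mul_eq_zero.1 h1 with h2 | h2
  · exact hy h2
  · rcases mul_eq_zero.1 (ENNReal.tsum_eq_zero.1 h2 z) with h3 | h3
    · exact hz h3
    · exact absurd (ENNReal.ofReal_eq_zero.1 h3) (not_le.2 (Real.exp_pos _))

theorem tsum_tiltWeight_ne_top (η : ℝ) (Z : Model X Y) (h : ℕ) (x : X) :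
    ∑' y, M.tiltWeight η Z h x y ≠ ∞ := by
  have hb : ∀ y, M.tiltWeight η Z h x y ≤ M.ref h x y * ENNReal.ofReal (Real.exp |1 / η|) := by
    intro y
    refine mul_le_mul_right ?_ _
    calc eexpect (Z h x y) (fun z => ENNReal.ofReal (Real.exp ((z : ℝ) / η)))
        ≤ ∑' z, Z h x y z * ENNReal.ofReal (Real.exp |1 / η|) := by
          refine ENNReal.tsum_le_tsum fun z => mul_le_mul_right ?_ _
          refine ENNReal.ofReal_le_ofReal (Real.exp_le_exp.2 ?_)
          calc (z : ℝ) / η ≤ |(z : ℝ) / η| := le_abs_self _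
            _ = (z : ℝ) * |1 / η| := by
              rw [div_eq_mul_one_div, abs_mul, abs_of_nonneg z.2.1]
            _ ≤ |1 / η| := mul_le_of_le_one_left (abs_nonneg _) z.2.2
      _ = ENNReal.ofReal (Real.exp |1 / η|) := by
          rw [ENNReal.tsum_mul_right, (Z h x y).tsum_coe, one_mul]
  refine ne_top_of_le_ne_top ?_ (ENNReal.tsum_le_tsum hb)
  rw [ENNReal.tsum_mul_right, (M.ref h x).tsum_coe, one_mul]
  exact ENNReal.ofReal_ne_top

/-- The policy `π^{Z,η}_h(y ∣ x) ∝ π^ref_h(y ∣ x) · E_{z ∼ Z_h(x,y)} exp(z / η)`. -/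
def tiltedPolicy (η : ℝ) (Z : Model X Y) : Policy X Y := fun h x =>
  PMF.normalize (M.tiltWeight η Z h x) (M.tsum_tiltWeight_ne_zero η Z h x)
    (M.tsum_tiltWeight_ne_top η Z h x)

/-- The data `(x_h, y_h, R_h)` of one trajectory: roll in with `π` to `x_h`, play a uniformly
random `y_h`, follow the reference policy to the end, and let `R_h = ∑_{t ≥ h} r_t`. -/
def sampleLaw [Fintype Y] [Nonempty Y] (π : Policy X Y) (h : ℕ) : PMF (X × Y × ℝ) :=
  (M.rollInUnifLaw π h).bind fun xy => (M.Zstar h xy.1 xy.2).map fun R => (xy.1, xy.2, R)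

/-- The record of one iteration: the model `Ẑ_k`, and one data point for each step `h`. -/
abbrev Iteration (M : DetMDP X Y) := Model X Y × (Fin M.H → X × Y × ℝ)

/-- An online learner: the (possibly randomized) next model, given the previous iterations.
At the start (empty past) it is the random initialization. -/
abbrev Oracle (M : DetMDP X Y) := (k : ℕ) → (Fin k → M.Iteration) → PMF (Model X Y)

/-- The law of the first `k` iterations of the algorithm. In each one the learner
gives `Ẑ`, and for every step `h < H` an independent trajectory is sampled with `π^{Ẑ,η}`. -/
def runLaw [Fintype Y] [Nonempty Y] (η : ℝ) (O : M.Oracle) : (k : ℕ) → PMF (Fin k → M.Iteration)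
  | 0 => PMF.pure Fin.elim0
  | k + 1 => (runLaw η O k).bind fun past => (O k past).bind fun Z =>
      (indepLaw (M.sampleLaw (M.tiltedPolicy η Z)) M.H).map fun d =>
        Fin.snoc (α := fun _ => M.Iteration) past (Z, d)

/-- `Z⋆ ∈ F`. -/
def Realizable (F : Set (Model X Y)) : Prop :=
  ∃ f ∈ F, ∀ h < M.H, ∀ x y, (f h x y).map (Subtype.val : unitInterval → ℝ) = M.Zstar h x y

/-- `O` is an online oracle for the maximum likelihood loss, with values in `F` and with regret
at most `Reg` after `K` iterations: for any data whatsoever (with `R_{h,k}` a possible value of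
`Z⋆_h(x_{h,k}, y_{h,k})`, so that `log Z⋆_h(R_{h,k} ∣ x_{h,k}, y_{h,k})` is finite) and any outputs
of the oracle along these data, the log-likelihoods of the outputs are finite and
`∑_k ∑_h (log Z⋆_h(R_{h,k} ∣ x_{h,k}, y_{h,k}) - log Ẑ_{h,k}(R_{h,k} ∣ x_{h,k}, y_{h,k})) ≤ Reg`. -/
def IsMLEOracle (F : Set (Model X Y)) (K : ℕ) (Reg : ℝ) (O : M.Oracle) : Prop :=
  (∀ k past, (O k past).support ⊆ F) ∧
  ∀ run : Fin K → M.Iteration,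
    (∀ k : Fin K, (run k).1 ∈ (O k fun i => run (Fin.castLE k.2.le i)).support) →
    (∀ (k : Fin K) (h : Fin M.H), ((run k).2 h).2.2 ∈
      (M.Zstar h ((run k).2 h).1 ((run k).2 h).2.1).support) →
    (∀ (k : Fin K) (h : Fin M.H),
      0 < likelihood (run k).1 h ((run k).2 h).1 ((run k).2 h).2.1 ((run k).2 h).2.2) ∧
    ∑ k : Fin K, ∑ h : Fin M.H,
      (Real.log (M.Zstar h ((run k).2 h).1 ((run k).2 h).2.1 ((run k).2 h).2.2).toReal -
        Real.log (likelihood (run k).1 h ((run k).2 h).1 ((run k).2 h).2.1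
          ((run k).2 h).2.2)) ≤ Reg

/-- The coefficient of variation of `exp(Z⋆_h(x, y) / η)`. -/
def cv (η : ℝ) (h : ℕ) (x : X) (y : Y) : ℝ :=
  √(variance (M.Zstar h x y) fun z => Real.exp (z / η)) /
    expect (M.Zstar h x y) fun z => Real.exp (z / η)

/-- The envelope `‖exp((1 - Q^{⋆,η}_h(x_h, y_h)) / η)‖_{L_∞(π^ref)}`. -/
def envelope [Fintype Y] (η : ℝ) (h : ℕ) : ℝ≥0∞ :=
  linfNorm (M.stateActionLaw M.ref h) fun xy =>
    ENNReal.ofReal (Real.exp ((1 - M.softQ η h xy.1 xy.2) / η))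

/-- The second-order bound
`A (√(∑_h ∑_k E_{x_h ∼ π^k, y_h ∼ Unif}[CV²] · β) + max_h E_h · β)`, for rewards-to-go
in `[0, 1]`. -/
def cvBound [Fintype Y] [Nonempty Y] (η β : ℝ) {K : ℕ} (π : Fin K → Policy X Y) : ℝ≥0∞ :=
  (Fintype.card Y : ℝ≥0∞) *
    (((∑ h ∈ Finset.range M.H, ∑ k, eexpect (M.rollInUnifLaw (π k) h) fun xy =>
          ENNReal.ofReal (M.cv η h xy.1 xy.2 ^ 2)) * ENNReal.ofReal β) ^ (1 / 2 : ℝ) +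
      (⨆ h ∈ Finset.range M.H, M.envelope η h) * ENNReal.ofReal β)

/-- The Bernoulli bound
`A (√(∑_h ∑_k E_{x_h ∼ π^k, y_h ∼ Unif}[(1 - p_h) / p_h] · β) + max_h ‖1 / p_h‖_{L_∞(π^ref)} · β)`,
where `1 / 0 = ∞`. -/
def bernoulliBound [Fintype Y] [Nonempty Y] (p : ℕ → X → Y → unitInterval) (β : ℝ) {K : ℕ}
    (π : Fin K → Policy X Y) : ℝ≥0∞ :=
  (Fintype.card Y : ℝ≥0∞) *
    (((∑ h ∈ Finset.range M.H, ∑ k, eexpect (M.rollInUnifLaw (π k) h) fun xy =>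
          ENNReal.ofReal (1 - (p h xy.1 xy.2 : ℝ)) / ENNReal.ofReal (p h xy.1 xy.2 : ℝ)) *
        ENNReal.ofReal β) ^ (1 / 2 : ℝ) +
      (⨆ h ∈ Finset.range M.H, linfNorm (M.stateActionLaw M.ref h) fun xy =>
          1 / ENNReal.ofReal (p h xy.1 xy.2 : ℝ)) * ENNReal.ofReal β)

end DetMDP

end QSharp

end

/-! Since transitions are deterministic, exponentiating the soft Bellman equations makes them
linear, so `exp (Q⋆ / η)` is the exponential moment of `Z⋆` (`ofReal_exp_softQ`). A learned model
thus determines a tilt `n` that replaces the optimal tilt `m = exp (Q⋆ / η)`, and regret is the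
price of this replacement.

Statistics: the square root of the likelihood ratio of model and truth has mean `1 - e / 2 ≤ exp (-e
/ 2)`, where `e` is the expected squared Hellinger error (without the factor 1/2). Products of these
ratios times `exp (e / 2)` form a supermartingale of mean at most 1. The oracle's regret bounds it
below on every run, so Markov's inequality bounds the cumulative error by `2 * (log (1 / δ) + Reg)`
(`one_sub_le_toOuterMeasure_runLaw`).

Regret: the performance difference identity (`optValue_sub_value`) writes it as a sum of one-step
gaps along the learner's own states, and each gap is at most three times the sum over actions of `|n
/ m - 1|` (`tilting_gap_le`). A second-order change-of-mean bound (`ofReal_abs_expect_sub_le`),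
divided by `m`, controls this by CV times Hellinger distance plus envelope times squared Hellinger
distance. Cauchy-Schwarz over all iterations, steps and state-action pairs gives the first
inequality.

For Bernoulli returns `m = p * exp (1 / η) + 1 - p`. It is at least `p * exp (1 / η)`, so the
exponential factors cancel in CV and in the envelope; this is the second inequality. -/

namespace QSharp

/-! ### Expectations under discrete distributions. -/

section Expectation

variable {α β ι : Type*}

theorem eexpect_bind (μ : PMF α) (κ : α → PMF β) (f : β → ℝ≥0∞) :
    eexpect (μ.bind κ) f = eexpect μ fun a => eexpect (κ a) f := by
  simp only [eexpect, PMF.bind_apply, ← ENNReal.tsum_mul_right, ← ENNReal.tsum_mul_left]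
  rw [ENNReal.tsum_comm]
  simp only [mul_assoc]

theorem eexpect_pure (a : α) (f : α → ℝ≥0∞) : eexpect (PMF.pure a) f = f a := by
  rw [eexpect, tsum_eq_single a]
  · simp
  · intro b hb
    simp [hb]

theorem eexpect_map (μ : PMF α) (g : α → β) (f : β → ℝ≥0∞) :
    eexpect (μ.map g) f = eexpect μ fun a => f (g a) := by
  simp only [PMF.map, eexpect_bind, Function.comp_apply, eexpect_pure]

theorem eexpect_mono (μ : PMF α) {f g : α → ℝ≥0∞} (hfg : ∀ a ∈ μ.support, f a ≤ g a) :
    eexpect μ f ≤ eexpect μ g := by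
  refine ENNReal.tsum_le_tsum fun a => ?_
  by_cases ha : μ a = 0
  · simp [ha]
  · exact mul_le_mul_right (hfg a ha) _

theorem eexpect_congr (μ : PMF α) {f g : α → ℝ≥0∞} (hfg : ∀ a ∈ μ.support, f a = g a) :
    eexpect μ f = eexpect μ g :=
  le_antisymm (eexpect_mono μ fun a ha => (hfg a ha).le) (eexpect_mono μ fun a ha => (hfg a ha).ge)

theorem eexpect_add (μ : PMF α) (f g : α → ℝ≥0∞) :
    eexpect μ (fun a => f a + g a) = eexpect μ f + eexpect μ g := by
  simp only [eexpect, mul_add, ENNReal.tsum_add]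

theorem eexpect_const (μ : PMF α) (c : ℝ≥0∞) : eexpect μ (fun _ => c) = c := by
  rw [eexpect, ENNReal.tsum_mul_right, μ.tsum_coe, one_mul]

theorem eexpect_const_mul (μ : PMF α) (c : ℝ≥0∞) (f : α → ℝ≥0∞) :
    eexpect μ (fun a => c * f a) = c * eexpect μ f := by
  rw [eexpect, eexpect, ← ENNReal.tsum_mul_left]
  simp only [mul_left_comm]

theorem eexpect_mul_const (μ : PMF α) (c : ℝ≥0∞) (f : α → ℝ≥0∞) :
    eexpect μ (fun a => f a * c) = eexpect μ f * c := by
  simp only [mul_comm _ c, eexpect_const_mul]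

/-- The Markov inequality, for the probability of the complementary event. -/
theorem one_sub_le_toOuterMeasure (μ : PMF α) (W : α → ℝ≥0∞) (hW : eexpect μ W ≤ 1) {δ : ℝ}
    (hδ : 0 < δ) {s : Set α} (hs : ∀ a ∈ μ.support, W a ≤ ENNReal.ofReal (1 / δ) → a ∈ s) :
    ENNReal.ofReal (1 - δ) ≤ μ.toOuterMeasure s := by
  have hδ' : ENNReal.ofReal δ * ENNReal.ofReal (1 / δ) = 1 := by
    rw [← ENNReal.ofReal_mul hδ.le, mul_one_div_cancel hδ.ne', ENNReal.ofReal_one]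
  have key : (1 : ℝ≥0∞) ≤ μ.toOuterMeasure s + ENNReal.ofReal δ := by
    calc (1 : ℝ≥0∞) = ∑' a, μ a := μ.tsum_coe.symm
      _ ≤ ∑' a, (s.indicator μ a + ENNReal.ofReal δ * (μ a * W a)) := by
          refine ENNReal.tsum_le_tsum fun a => ?_
          by_cases has : a ∈ s
          · rw [Set.indicator_of_mem has]
            exact le_self_add
          by_cases ha : μ a = 0
          · simp [ha]
          have hWa : ENNReal.ofReal (1 / δ) ≤ W a := (not_le.1 fun h => has (hs a ha h)).le
          calc μ a = μ a * (ENNReal.ofReal δ * ENNReal.ofReal (1 / δ)) := by rw [hδ', mul_one]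
            _ ≤ μ a * (ENNReal.ofReal δ * W a) := by gcongr
            _ = ENNReal.ofReal δ * (μ a * W a) := mul_left_comm _ _ _
            _ ≤ _ := le_add_self
      _ = μ.toOuterMeasure s + ENNReal.ofReal δ * eexpect μ W := by
          rw [ENNReal.tsum_add, ENNReal.tsum_mul_left, PMF.toOuterMeasure_apply, eexpect]
      _ ≤ μ.toOuterMeasure s + ENNReal.ofReal δ * 1 := by gcongr
      _ = _ := by rw [mul_one]
  rw [ENNReal.ofReal_sub _ hδ.le, ENNReal.ofReal_one]
  exact tsub_le_iff_right.2 key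

/-- The Cauchy-Schwarz inequality for weighted sums in `[0, ∞]`. -/
theorem tsum_mul_mul_le_rpow (w a b : ι → ℝ≥0∞) :
    ∑' i, w i * (a i * b i) ≤
      (∑' i, w i * a i ^ 2) ^ (1 / 2 : ℝ) * (∑' i, w i * b i ^ 2) ^ (1 / 2 : ℝ) := by
  -- With the top σ-algebra everything is measurable and sums are integrals against counting
  -- measure; the weight is split as `w^(1/2) * w^(1/2)` for Hölder's inequality.
  let _ : MeasurableSpace ι := ⊤
  have h := ENNReal.lintegral_mul_le_Lp_mul_Lq (α := ι)
    MeasureTheory.Measure.count (p := 2) (q := 2) (by norm_num [Real.holderConjugate_iff])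
    (f := fun i => w i ^ (1 / 2 : ℝ) * a i) (g := fun i => w i ^ (1 / 2 : ℝ) * b i)
    (measurable_from_top.aemeasurable) (measurable_from_top.aemeasurable)
  have hw : ∀ i, w i ^ (1 / 2 : ℝ) * w i ^ (1 / 2 : ℝ) = w i := by
    intro i
    rw [← ENNReal.rpow_add_of_nonneg _ _ (by norm_num) (by norm_num)]
    norm_num
  have hsq : ∀ (c : ι → ℝ≥0∞) i, (w i ^ (1 / 2 : ℝ) * c i) ^ (2 : ℝ) = w i * c i ^ 2 := by
    intro c i
    rw [ENNReal.rpow_two, mul_pow, pow_two (w i ^ _), hw]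
  simp only [Pi.mul_apply, MeasureTheory.lintegral_count' measurable_from_top, hsq] at h
  refine le_trans (le_of_eq ?_) h
  refine tsum_congr fun i => ?_
  rw [mul_mul_mul_comm, hw]

theorem summable_toReal (μ : PMF α) : Summable fun a => (μ a).toReal :=
  ENNReal.summable_toReal μ.tsum_coe_ne_top

theorem tsum_toReal (μ : PMF α) : ∑' a, (μ a).toReal = 1 := by
  rw [← ENNReal.tsum_toReal_eq fun a => μ.apply_ne_top a, μ.tsum_coe, ENNReal.toReal_one]

theorem summable_mul_of_bounded (μ : PMF α) {f : α → ℝ} {B : ℝ}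
    (hf : ∀ a ∈ μ.support, |f a| ≤ B) : Summable fun a => (μ a).toReal * f a := by
  refine Summable.of_norm_bounded ((summable_toReal μ).mul_right B) fun a => ?_
  rw [norm_mul, Real.norm_of_nonneg ENNReal.toReal_nonneg, Real.norm_eq_abs]
  by_cases ha : μ a = 0
  · simp [ha]
  · exact mul_le_mul_of_nonneg_left (hf a ha) ENNReal.toReal_nonneg

theorem expect_const (μ : PMF α) (c : ℝ) : expect μ (fun _ => c) = c := by
  rw [expect, tsum_mul_right, tsum_toReal, one_mul]

theorem expect_add (μ : PMF α) {f g : α → ℝ} {B C : ℝ} (hf : ∀ a ∈ μ.support, |f a| ≤ B)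
    (hg : ∀ a ∈ μ.support, |g a| ≤ C) :
    expect μ (fun a => f a + g a) = expect μ f + expect μ g := by
  simp only [expect, mul_add]
  exact (summable_mul_of_bounded μ hf).tsum_add (summable_mul_of_bounded μ hg)

theorem expect_sub (μ : PMF α) {f g : α → ℝ} {B C : ℝ} (hf : ∀ a ∈ μ.support, |f a| ≤ B)
    (hg : ∀ a ∈ μ.support, |g a| ≤ C) :
    expect μ (fun a => f a - g a) = expect μ f - expect μ g := by
  simp only [expect, mul_sub]
  exact (summable_mul_of_bounded μ hf).tsum_sub (summable_mul_of_bounded μ hg)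

theorem ofReal_expect (μ : PMF α) {f : α → ℝ} {B : ℝ} (hf0 : ∀ a, 0 ≤ f a)
    (hf : ∀ a ∈ μ.support, |f a| ≤ B) :
    ENNReal.ofReal (expect μ f) = eexpect μ fun a => ENNReal.ofReal (f a) := by
  rw [expect, ENNReal.ofReal_tsum_of_nonneg (fun a => mul_nonneg ENNReal.toReal_nonneg (hf0 a))
    (summable_mul_of_bounded μ hf)]
  refine tsum_congr fun a => ?_
  rw [ENNReal.ofReal_mul ENNReal.toReal_nonneg, ENNReal.ofReal_toReal (μ.apply_ne_top a)]

theorem ofReal_expect_le (μ : PMF α) {f : α → ℝ} {B : ℝ} (hf : ∀ a ∈ μ.support, |f a| ≤ B) :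
    ENNReal.ofReal (expect μ f) ≤ eexpect μ fun a => ENNReal.ofReal (f a) := by
  have hmax : ∀ a ∈ μ.support, |max (f a) 0| ≤ B := fun a ha => by
    rw [abs_of_nonneg (le_max_right _ _)]
    exact max_le ((le_abs_self _).trans (hf a ha)) ((abs_nonneg _).trans (hf a ha))
  calc ENNReal.ofReal (expect μ f) ≤ ENNReal.ofReal (expect μ fun a => max (f a) 0) := by
        refine ENNReal.ofReal_le_ofReal ?_
        exact (summable_mul_of_bounded μ hf).tsum_le_tsum
          (fun a => mul_le_mul_of_nonneg_left (le_max_left _ _) ENNReal.toReal_nonneg)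
          (summable_mul_of_bounded μ hmax)
    _ = eexpect μ fun a => ENNReal.ofReal (max (f a) 0) :=
        ofReal_expect μ (fun a => le_max_right _ _) hmax
    _ = _ := by simp [ENNReal.ofReal_max]

/-- Shifting by the bound makes the integrand nonnegative, so that `expect_bind` can interchange
sums in `[0, ∞]`, where no summability is at stake. -/
theorem expect_eq_toReal_sub (μ : PMF α) {f : α → ℝ} {B : ℝ} (hf : ∀ a, |f a| ≤ B) :
    expect μ f = (eexpect μ fun a => ENNReal.ofReal (f a + B)).toReal - B := by
  have h0 : ∀ a, 0 ≤ f a + B := fun a => by linarith [neg_le_of_abs_le (hf a)]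
  have h1 : expect μ (fun a => f a + B) = expect μ f + B := by
    rw [expect_add μ (fun a _ => hf a) (fun _ _ => le_rfl), expect_const]
  rw [← ofReal_expect μ h0 (B := 2 * B), ENNReal.toReal_ofReal, h1, add_sub_cancel_right]
  · exact tsum_nonneg fun a => mul_nonneg ENNReal.toReal_nonneg (h0 a)
  · intro a _
    rw [abs_of_nonneg (h0 a)]
    linarith [le_of_abs_le (hf a)]

theorem abs_expect_le (μ : PMF α) {f : α → ℝ} {B : ℝ} (hf : ∀ a ∈ μ.support, |f a| ≤ B) :
    |expect μ f| ≤ B := by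
  rw [← Real.norm_eq_abs, expect]
  refine tsum_of_norm_bounded (g := fun a => (μ a).toReal * B) ?_ fun a => ?_
  · have h := (summable_toReal μ).hasSum.mul_right B
    rwa [tsum_toReal, one_mul] at h
  · rw [norm_mul, Real.norm_of_nonneg ENNReal.toReal_nonneg, Real.norm_eq_abs]
    by_cases ha : μ a = 0
    · simp [ha]
    · exact mul_le_mul_of_nonneg_left (hf a ha) ENNReal.toReal_nonneg

theorem expect_bind (μ : PMF α) (κ : α → PMF β) {f : β → ℝ} {B : ℝ} (hf : ∀ b, |f b| ≤ B) :
    expect (μ.bind κ) f = expect μ fun a => expect (κ a) f := by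
  have h0 : ∀ b, 0 ≤ f b + B := fun b => by linarith [neg_le_of_abs_le (hf b)]
  rw [expect_eq_toReal_sub _ hf,
    expect_eq_toReal_sub _ (fun a => abs_expect_le (κ a) fun b _ => hf b),
    eexpect_bind]
  congr 2
  refine eexpect_congr μ fun a _ => ?_
  rw [expect_eq_toReal_sub (κ a) hf, sub_add_cancel, ENNReal.ofReal_toReal]
  refine ne_top_of_le_ne_top (ENNReal.ofReal_ne_top (r := 2 * B)) ?_
  refine (eexpect_mono (κ a) fun b _ => ENNReal.ofReal_le_ofReal ?_).trans
    (eexpect_const (κ a) _).le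
  linarith [le_of_abs_le (hf b)]

theorem expect_pure (a : α) (f : α → ℝ) : expect (PMF.pure a) f = f a := by
  rw [expect, tsum_eq_single a]
  · simp
  · intro b hb
    simp [hb]

theorem expect_map (μ : PMF α) (g : α → β) {f : β → ℝ} {B : ℝ} (hf : ∀ b, |f b| ≤ B) :
    expect (μ.map g) f = expect μ fun a => f (g a) := by
  simp only [PMF.map, expect_bind _ _ hf, Function.comp_apply, expect_pure]

theorem eexpect_indepLaw {D : Type*} (p : ℕ → PMF D) (f : ℕ → D → ℝ≥0∞) (n : ℕ) :
    (eexpect (indepLaw p n) fun d => ∏ i : Fin n, f i (d i)) =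
      ∏ i : Fin n, eexpect (p i) (f i) := by
  induction n with
  | zero => simp [indepLaw, eexpect_pure]
  | succ n ih =>
    rw [Fin.prod_univ_castSucc]
    simp only [Fin.val_castSucc, Fin.val_last]
    rw [← ih, indepLaw, eexpect_bind, ← eexpect_mul_const]
    refine eexpect_congr _ fun d _ => ?_
    rw [eexpect_map, ← eexpect_const_mul]
    simp only [Fin.prod_univ_castSucc, Fin.snoc_castSucc, Fin.snoc_last, Fin.val_castSucc,
      Fin.val_last]

theorem mem_support_indepLaw {D : Type*} (p : ℕ → PMF D) (n : ℕ) {d : Fin n → D}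
    (hd : d ∈ (indepLaw p n).support) (i : Fin n) : d i ∈ (p i).support := by
  induction n with
  | zero => exact i.elim0
  | succ n ih =>
    rw [indepLaw, PMF.mem_support_bind_iff] at hd
    obtain ⟨d', hd', h⟩ := hd
    rw [PMF.mem_support_map_iff] at h
    obtain ⟨a, ha, rfl⟩ := h
    refine Fin.lastCases ?_ (fun j => ?_) i
    · simpa using ha
    · simpa using ih hd' j

end Expectation

end QSharp

namespace QSharp

/-! ### Hellinger distance and the change of mean. -/

section Hellinger

variable {α : Type*}

/-- Twice the squared Hellinger distance of two discrete distributions. -/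
noncomputable def hellingerSq (p q : PMF α) : ℝ≥0∞ :=
  ∑' a, ENNReal.ofReal ((√(p a).toReal - √(q a).toReal) ^ 2)

/-- Pointwise, `2√(pq) + (√p - √q)² = p + q`, and both masses are 1. Mass of `q` outside the support
of `p` is counted by the Hellinger term alone. -/
theorem two_mul_eexpect_sqrt_ratio_add_hellingerSq (p q : PMF α) :
    2 * (eexpect p fun a => ENNReal.ofReal √((q a).toReal / (p a).toReal)) + hellingerSq p q =
      2 := by
  have h2 : (∑' a, p a) + ∑' a, q a = 2 := by
    rw [p.tsum_coe, q.tsum_coe, one_add_one_eq_two]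
  rw [eexpect, hellingerSq, ← ENNReal.tsum_mul_left, ← ENNReal.tsum_add]
  refine Eq.trans ?_ h2
  rw [← ENNReal.tsum_add]
  refine tsum_congr fun a => ?_
  have hp : 0 ≤ (p a).toReal := ENNReal.toReal_nonneg
  have hq : 0 ≤ (q a).toReal := ENNReal.toReal_nonneg
  have hmul : (p a).toReal * √((q a).toReal / (p a).toReal) = √(p a).toReal * √(q a).toReal := by
    rcases hp.eq_or_lt with h0 | h0
    · simp [← h0]
    · rw [Real.sqrt_div hq]
      have hs : √(p a).toReal ≠ 0 := (Real.sqrt_pos.2 h0).ne'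
      field_simp
      rw [Real.sq_sqrt hp]
      ring
  have hpa : p a = ENNReal.ofReal (p a).toReal := (ENNReal.ofReal_toReal (p.apply_ne_top a)).symm
  have hqa : q a = ENNReal.ofReal (q a).toReal := (ENNReal.ofReal_toReal (q.apply_ne_top a)).symm
  have htwo : (2 : ℝ≥0∞) = ENNReal.ofReal 2 := by simp
  calc 2 * (p a * ENNReal.ofReal √((q a).toReal / (p a).toReal)) +
        ENNReal.ofReal ((√(p a).toReal - √(q a).toReal) ^ 2)
      = ENNReal.ofReal (2 * (√(p a).toReal * √(q a).toReal) +
          (√(p a).toReal - √(q a).toReal) ^ 2) := by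
        rw [ENNReal.ofReal_add (by positivity) (by positivity), ENNReal.ofReal_mul (by norm_num),
          ← hmul, ENNReal.ofReal_mul hp, ← hpa, ← htwo]
    _ = ENNReal.ofReal ((p a).toReal + (q a).toReal) := by
        congr 1
        linear_combination Real.sq_sqrt hp + Real.sq_sqrt hq
    _ = p a + q a := by rw [ENNReal.ofReal_add hp hq, ← hpa, ← hqa]

theorem hellingerSq_le_two (p q : PMF α) : hellingerSq p q ≤ 2 :=
  le_add_self.trans (two_mul_eexpect_sqrt_ratio_add_hellingerSq p q).le

theorem variance_nonneg (p : PMF α) (f : α → ℝ) : 0 ≤ variance p f :=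
  tsum_nonneg fun _ => mul_nonneg ENNReal.toReal_nonneg (sq_nonneg _)

theorem ofReal_variance (p : PMF α) {f : α → ℝ} {B : ℝ}
    (hf : ∀ a ∈ p.support, |f a - expect p f| ≤ B) :
    ENNReal.ofReal (variance p f) =
      ∑' a, p a * ENNReal.ofReal |f a - expect p f| ^ 2 := by
  rw [variance, ofReal_expect p (B := B ^ 2) (fun a => sq_nonneg _)]
  · refine tsum_congr fun a => ?_
    rw [← ENNReal.ofReal_pow (abs_nonneg _), sq_abs]
  · intro a ha
    rw [abs_pow]
    exact pow_le_pow_left₀ (abs_nonneg _) (hf a ha) 2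

/-- The change of mean of a function with values in `[0, B]`, bounded by its standard deviation
and the Hellinger distance. -/
theorem ofReal_abs_expect_sub_le (p q : PMF α) {f : α → ℝ} {B : ℝ} (hf0 : ∀ a, 0 ≤ f a)
    (hp : ∀ a ∈ p.support, f a ≤ B) (hq : ∀ a ∈ q.support, f a ≤ B) :
    ENNReal.ofReal |expect q f - expect p f| ≤
      2 * (ENNReal.ofReal √(variance p f) * hellingerSq p q ^ (1 / 2 : ℝ)) +
        ENNReal.ofReal B * hellingerSq p q := by
  have habs : ∀ μ : PMF α, (∀ a ∈ μ.support, f a ≤ B) → ∀ a ∈ μ.support, |f a| ≤ B :=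
    fun μ h a ha => (abs_of_nonneg (hf0 a)).trans_le (h a ha)
  set m := expect p f with hm
  have hm0 : 0 ≤ m := tsum_nonneg fun a => mul_nonneg ENNReal.toReal_nonneg (hf0 a)
  have hmB : m ≤ B := (le_abs_self _).trans (abs_expect_le p (habs p hp))
  have hdev : ∀ a, f a ≤ B → |f a - m| ≤ B := fun a ha =>
    abs_le.2 ⟨by linarith [hf0 a], by linarith⟩
  have hsum : ∀ μ : PMF α, (∀ a ∈ μ.support, f a ≤ B) →
      Summable fun a => (μ a).toReal * (f a - m) := fun μ h =>
    summable_mul_of_bounded μ fun a ha => hdev a (h a ha)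
  have hcent : ∀ μ : PMF α, (∀ a ∈ μ.support, f a ≤ B) →
      ∑' a, (μ a).toReal * (f a - m) = expect μ f - m := fun μ h => by
    have := expect_sub μ (habs μ h) (g := fun _ => m) (C := |m|) fun _ _ => le_rfl
    rwa [expect_const] at this
  -- Centering at `m` is free because `p` and `q` have equal mass; it is what makes the variance
  -- appear.
  have hdiff : expect q f - m = ∑' a, ((q a).toReal - (p a).toReal) * (f a - m) := by
    simp only [sub_mul _ _ (f _ - m)]
    rw [(hsum q hq).tsum_sub (hsum p hp), hcent q hq, hcent p hp]
    simp [hm]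
  have hsum' : Summable fun a => ((q a).toReal - (p a).toReal) * (f a - m) := by
    simp only [sub_mul _ _ (f _ - m)]
    exact (hsum q hq).sub (hsum p hp)
  -- With `s = √p`, `t = √q`: `q - p = -2s(s - t) + (s - t)²`. The linear term keeps only `s`, so
  -- Cauchy-Schwarz yields the variance under `p` alone; the quadratic term uses `|f - m| ≤ B`. The
  -- factor 1 is the weight in `tsum_mul_mul_le_rpow`.
  have hpt : ∀ a, ENNReal.ofReal ‖((q a).toReal - (p a).toReal) * (f a - m)‖ ≤
      2 * (1 * ((ENNReal.ofReal √(p a).toReal * ENNReal.ofReal |f a - m|) *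
        ENNReal.ofReal |√(p a).toReal - √(q a).toReal|)) +
      ENNReal.ofReal B * ENNReal.ofReal ((√(p a).toReal - √(q a).toReal) ^ 2) := by
    intro a
    have hp0 : 0 ≤ (p a).toReal := ENNReal.toReal_nonneg
    have hq0 : 0 ≤ (q a).toReal := ENNReal.toReal_nonneg
    have hB0 : 0 ≤ B := hm0.trans hmB
    rw [one_mul, ← ENNReal.ofReal_mul (by positivity), ← ENNReal.ofReal_mul (by positivity),
      show (2 : ℝ≥0∞) = ENNReal.ofReal 2 by simp, ← ENNReal.ofReal_mul (by norm_num),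
      ← ENNReal.ofReal_mul hB0, ← ENNReal.ofReal_add (by positivity) (by positivity)]
    refine ENNReal.ofReal_le_ofReal ?_
    rw [norm_mul, Real.norm_eq_abs, Real.norm_eq_abs]
    by_cases hpq : p a = 0 ∧ q a = 0
    · simp [hpq.1, hpq.2]
    have hfa : |f a - m| ≤ B := by
      by_cases hpa : p a = 0
      · exact hdev a (hq a fun hqa => hpq ⟨hpa, hqa⟩)
      · exact hdev a (hp a hpa)
    set s := √(p a).toReal with hs
    set t := √(q a).toReal with ht
    have hs0 : 0 ≤ s := Real.sqrt_nonneg _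
    have hdecomp : (q a).toReal - (p a).toReal = -(2 * s * (s - t)) + (s - t) ^ 2 := by
      linear_combination - Real.sq_sqrt hq0 + Real.sq_sqrt hp0
    calc |(q a).toReal - (p a).toReal| * |f a - m|
        ≤ (2 * s * |s - t| + (s - t) ^ 2) * |f a - m| := by
          refine mul_le_mul_of_nonneg_right ?_ (abs_nonneg _)
          rw [hdecomp]
          refine (abs_add_le _ _).trans_eq ?_
          rw [abs_neg, abs_mul, abs_of_nonneg (by positivity : 0 ≤ 2 * s),
            abs_of_nonneg (sq_nonneg (s - t))]
      _ = 2 * (s * |f a - m| * |s - t|) + |f a - m| * (s - t) ^ 2 := by ring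
      _ ≤ _ := by gcongr
  calc ENNReal.ofReal |expect q f - m|
      ≤ ENNReal.ofReal (∑' a, ‖((q a).toReal - (p a).toReal) * (f a - m)‖) := by
        refine ENNReal.ofReal_le_ofReal ?_
        rw [hdiff, ← Real.norm_eq_abs]
        exact norm_tsum_le_tsum_norm hsum'.norm
    _ = ∑' a, ENNReal.ofReal ‖((q a).toReal - (p a).toReal) * (f a - m)‖ :=
        ENNReal.ofReal_tsum_of_nonneg (fun _ => norm_nonneg _) hsum'.norm
    _ ≤ _ := ENNReal.tsum_le_tsum hpt
    _ ≤ _ := by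
        rw [ENNReal.tsum_add, ENNReal.tsum_mul_left, hellingerSq,
          ← ENNReal.tsum_mul_left (a := ENNReal.ofReal B)]
        refine add_le_add (mul_le_mul_right ?_ _) le_rfl
        refine (tsum_mul_mul_le_rpow _ _ _).trans (le_of_eq ?_)
        congr 1
        · rw [Real.sqrt_eq_rpow, ← ENNReal.ofReal_rpow_of_nonneg (variance_nonneg p f)
            (by norm_num),
            ofReal_variance p fun a ha => hdev a (hp a ha)]
          congr 1
          refine tsum_congr fun a => ?_
          rw [one_mul, mul_pow, ← ENNReal.ofReal_pow (Real.sqrt_nonneg _),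
            Real.sq_sqrt ENNReal.toReal_nonneg, ENNReal.ofReal_toReal (p.apply_ne_top a)]
        · congr 1
          refine tsum_congr fun a => ?_
          rw [one_mul, ← ENNReal.ofReal_pow (abs_nonneg _), sq_abs]

end Hellinger

end QSharp

namespace QSharp

namespace DetMDP

/-! ### The likelihood supermartingale and the cumulative model error. -/

section Likelihood

variable {X Y : Type*} [Fintype Y] [Nonempty Y] (M : DetMDP X Y)

/-- The expected squared Hellinger error of a model at step `h`, under the data distribution. -/
noncomputable def modelError (π : Policy X Y) (Z : Model X Y) (h : ℕ) : ℝ≥0∞ :=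
  eexpect (M.rollInUnifLaw π h) fun xy =>
    hellingerSq (M.Zstar h xy.1 xy.2) ((Z h xy.1 xy.2).map (Subtype.val : unitInterval → ℝ))

/-- The square root of the likelihood ratio of a model and the truth, at one data point. -/
noncomputable def sqrtRatio (Z : Model X Y) (h : ℕ) (d : X × Y × ℝ) : ℝ :=
  √(likelihood Z h d.1 d.2.1 d.2.2 / (M.Zstar h d.1 d.2.1 d.2.2).toReal)

theorem modelError_le_two (π : Policy X Y) (Z : Model X Y) (h : ℕ) : M.modelError π Z h ≤ 2 :=
  (eexpect_mono _ fun _ _ => hellingerSq_le_two _ _).trans (eexpect_const _ _).le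

theorem modelError_ne_top (π : Policy X Y) (Z : Model X Y) (h : ℕ) : M.modelError π Z h ≠ ∞ :=
  ne_top_of_le_ne_top (by simp) (M.modelError_le_two π Z h)

theorem two_mul_eexpect_sqrtRatio_add_modelError (π : Policy X Y) (Z : Model X Y) (h : ℕ) :
    2 * (eexpect (M.sampleLaw π h) fun d => ENNReal.ofReal (M.sqrtRatio Z h d)) +
      M.modelError π Z h = 2 := by
  rw [sampleLaw, eexpect_bind, ← eexpect_const_mul, modelError, ← eexpect_add]
  refine Eq.trans (eexpect_congr _ fun xy _ => ?_) (eexpect_const (M.rollInUnifLaw π h) 2)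
  rw [eexpect_map]
  simp only [sqrtRatio, likelihood]
  exact two_mul_eexpect_sqrt_ratio_add_hellingerSq (M.Zstar h xy.1 xy.2) _

/-- The mean of the square-root ratio is `1 - e / 2`, hence at most `exp (-e / 2)`. -/
theorem eexpect_sqrtRatio_mul_exp_le_one (π : Policy X Y) (Z : Model X Y) (h : ℕ) :
    (eexpect (M.sampleLaw π h) fun d => ENNReal.ofReal (M.sqrtRatio Z h d) *
      ENNReal.ofReal (Real.exp ((M.modelError π Z h).toReal / 2))) ≤ 1 := by
  rw [eexpect_mul_const]
  have key := M.two_mul_eexpect_sqrtRatio_add_modelError π Z h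
  set b := eexpect (M.sampleLaw π h) fun d => ENNReal.ofReal (M.sqrtRatio Z h d)
  have hb : b ≠ ∞ := by
    intro hb
    rw [hb] at key
    simp at key
  have hreal : 2 * b.toReal + (M.modelError π Z h).toReal = 2 := by
    have := congrArg ENNReal.toReal key
    rwa [ENNReal.toReal_add (ENNReal.mul_ne_top (by simp) hb) (M.modelError_ne_top π Z h),
      ENNReal.toReal_mul, ENNReal.toReal_ofNat] at this
  rw [← ENNReal.ofReal_toReal hb, ← ENNReal.ofReal_mul ENNReal.toReal_nonneg,
    ← ENNReal.ofReal_one]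
  refine ENNReal.ofReal_le_ofReal ?_
  set e := (M.modelError π Z h).toReal
  have h1 : b.toReal ≤ Real.exp (-(e / 2)) := by
    linarith [Real.add_one_le_exp (-(e / 2))]
  calc b.toReal * Real.exp (e / 2) ≤ Real.exp (-(e / 2)) * Real.exp (e / 2) := by gcongr
    _ = 1 := by rw [← Real.exp_add, neg_add_cancel, Real.exp_zero]

/-- The factor that one iteration contributes to the exponential supermartingale. -/
noncomputable def iterationFactor (η : ℝ) (it : M.Iteration) : ℝ≥0∞ :=
  ∏ h : Fin M.H, (ENNReal.ofReal (M.sqrtRatio it.1 h (it.2 h)) *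
    ENNReal.ofReal (Real.exp ((M.modelError (M.tiltedPolicy η it.1) it.1 h).toReal / 2)))

theorem eexpect_iterationFactor_le_one (η : ℝ) (Z : Model X Y) :
    (eexpect (indepLaw (M.sampleLaw (M.tiltedPolicy η Z)) M.H) fun d =>
      M.iterationFactor η (Z, d)) ≤ 1 := by
  have h := eexpect_indepLaw (M.sampleLaw (M.tiltedPolicy η Z))
    (fun h d => ENNReal.ofReal (M.sqrtRatio Z h d) *
      ENNReal.ofReal (Real.exp ((M.modelError (M.tiltedPolicy η Z) Z h).toReal / 2))) M.H
  refine h.le.trans ?_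
  exact Finset.prod_le_one' fun i _ => M.eexpect_sqrtRatio_mul_exp_le_one _ _ _

/-- Supermartingale property: given the past and the new model, the data of the `H` steps are
independent, so the last factor has conditional mean at most 1. -/
theorem eexpect_prod_iterationFactor_le_one (η : ℝ) (O : M.Oracle) (k : ℕ) :
    (eexpect (M.runLaw η O k) fun run => ∏ i, M.iterationFactor η (run i)) ≤ 1 := by
  induction k with
  | zero => simp [runLaw, eexpect_pure]
  | succ k ih =>
    rw [runLaw, eexpect_bind]
    refine le_trans (eexpect_mono _ fun past _ => ?_) ih
    rw [eexpect_bind]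
    refine le_trans (eexpect_mono _ fun Z _ => ?_) (eexpect_const (O k past) _).le
    rw [eexpect_map]
    simp only [Fin.prod_univ_castSucc, Fin.snoc_castSucc, Fin.snoc_last]
    rw [eexpect_const_mul]
    exact mul_le_of_le_one_right' (M.eexpect_iterationFactor_le_one η Z)

theorem mem_support_sampleLaw {π : Policy X Y} {h : ℕ} {d : X × Y × ℝ}
    (hd : d ∈ (M.sampleLaw π h).support) : d.2.2 ∈ (M.Zstar h d.1 d.2.1).support := by
  rw [sampleLaw, PMF.mem_support_bind_iff] at hd
  obtain ⟨xy, -, hd⟩ := hd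
  rw [PMF.mem_support_map_iff] at hd
  obtain ⟨R, hR, rfl⟩ := hd
  exact hR

/-- Supplies the two hypotheses under which `IsMLEOracle` guarantees its pathwise regret bound. -/
theorem mem_support_runLaw (η : ℝ) (O : M.Oracle) (k : ℕ) {run : Fin k → M.Iteration}
    (hrun : run ∈ (M.runLaw η O k).support) (i : Fin k) :
    (run i).1 ∈ (O i fun j => run (Fin.castLE i.2.le j)).support ∧
      ∀ h : Fin M.H, ((run i).2 h).2.2 ∈
        (M.Zstar h ((run i).2 h).1 ((run i).2 h).2.1).support := by
  induction k with
  | zero => exact i.elim0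
  | succ k ih =>
    rw [runLaw, PMF.mem_support_bind_iff] at hrun
    obtain ⟨past, hpast, hrun⟩ := hrun
    rw [PMF.mem_support_bind_iff] at hrun
    obtain ⟨Z, hZ, hrun⟩ := hrun
    rw [PMF.mem_support_map_iff] at hrun
    obtain ⟨d, hd, rfl⟩ := hrun
    refine Fin.lastCases ?_ (fun j => ?_) i
    · have hfun : (fun j : Fin k => Fin.snoc (α := fun _ => M.Iteration) past (Z, d)
          (Fin.castLE (Fin.last k).2.le j)) = past := by
        funext j
        exact Fin.snoc_castSucc (α := fun _ => M.Iteration) (Z, d) past j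
      refine ⟨?_, fun h => ?_⟩
      · simp only [Fin.snoc_last]
        exact (congrArg (fun q => Z ∈ (O k q).support) hfun).mpr hZ
      · simp only [Fin.snoc_last]
        exact M.mem_support_sampleLaw (mem_support_indepLaw _ _ hd h)
    · have hfun : (fun l : Fin j => Fin.snoc (α := fun _ => M.Iteration) past (Z, d)
          (Fin.castLE j.castSucc.2.le l)) = fun l => past (Fin.castLE j.2.le l) := by
        funext l
        exact Fin.snoc_castSucc (α := fun _ => M.Iteration) (Z, d) past (Fin.castLE j.2.le l)
      simp only [Fin.snoc_castSucc]
      obtain ⟨h1, h2⟩ := ih hpast j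
      exact ⟨hfun ▸ h1, h2⟩

/-- On the runs of the algorithm the supermartingale is controlled by the likelihood regret. -/
theorem ofReal_exp_le_prod_iterationFactor {F : Set (Model X Y)} {K : ℕ} {Reg : ℝ}
    {O : M.Oracle} (hO : M.IsMLEOracle F K Reg O) (η : ℝ) {run : Fin K → M.Iteration}
    (hrun : run ∈ (M.runLaw η O K).support) :
    ENNReal.ofReal (Real.exp (∑ k, ∑ h : Fin M.H,
      (M.modelError (M.tiltedPolicy η (run k).1) (run k).1 h).toReal / 2 - Reg / 2)) ≤
      ∏ i, M.iterationFactor η (run i) := by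
  have hsupp := M.mem_support_runLaw η O K hrun
  obtain ⟨hpos, hreg⟩ := hO.2 run (fun k => (hsupp k).1) fun k h => (hsupp k).2 h
  have hratio : ∀ (k : Fin K) (h : Fin M.H), M.sqrtRatio (run k).1 h ((run k).2 h) =
      Real.exp (-(Real.log (M.Zstar h ((run k).2 h).1 ((run k).2 h).2.1 ((run k).2 h).2.2).toReal -
        Real.log (likelihood (run k).1 h ((run k).2 h).1 ((run k).2 h).2.1
          ((run k).2 h).2.2)) / 2) := by
    intro k h
    have hZ : 0 < (M.Zstar h ((run k).2 h).1 ((run k).2 h).2.1 ((run k).2 h).2.2).toReal :=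
      ENNReal.toReal_pos ((hsupp k).2 h) (PMF.apply_ne_top _ _)
    rw [neg_sub, ← Real.log_div (hpos k h).ne' hZ.ne', Real.exp_half,
      Real.exp_log (div_pos (hpos k h) hZ), sqrtRatio]
  have hprod : ∏ i, M.iterationFactor η (run i) = ENNReal.ofReal (Real.exp (∑ k, ∑ h : Fin M.H,
      (-(Real.log (M.Zstar h ((run k).2 h).1 ((run k).2 h).2.1 ((run k).2 h).2.2).toReal -
        Real.log (likelihood (run k).1 h ((run k).2 h).1 ((run k).2 h).2.1
          ((run k).2 h).2.2)) / 2 +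
      (M.modelError (M.tiltedPolicy η (run k).1) (run k).1 h).toReal / 2))) := by
    rw [Real.exp_sum, ENNReal.ofReal_prod_of_nonneg fun _ _ => (Real.exp_pos _).le]
    refine Finset.prod_congr rfl fun k _ => ?_
    rw [Real.exp_sum, ENNReal.ofReal_prod_of_nonneg fun _ _ => (Real.exp_pos _).le,
      iterationFactor]
    refine Finset.prod_congr rfl fun h _ => ?_
    rw [hratio, Real.exp_add, ENNReal.ofReal_mul (Real.exp_pos _).le]
  rw [hprod]
  refine ENNReal.ofReal_le_ofReal (Real.exp_le_exp.2 ?_)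
  simp only [Finset.sum_add_distrib, ← Finset.sum_div, Finset.sum_neg_distrib]
  linarith

/-- Dropping the model errors leaves `exp (-Reg / 2)` as a lower bound of the supermartingale on
every run, while its mean is at most 1. The temperature 1 is arbitrary. -/
theorem regret_nonneg {F : Set (Model X Y)} {K : ℕ} {Reg : ℝ} {O : M.Oracle}
    (hO : M.IsMLEOracle F K Reg O) : 0 ≤ Reg := by
  have h1 : ENNReal.ofReal (Real.exp (-(Reg / 2))) ≤ 1 := by
    rw [← eexpect_const (M.runLaw 1 O K) (ENNReal.ofReal (Real.exp (-(Reg / 2))))]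
    refine le_trans (eexpect_mono _ fun run hrun => ?_)
      (M.eexpect_prod_iterationFactor_le_one 1 O K)
    refine le_trans (ENNReal.ofReal_le_ofReal (Real.exp_le_exp.2 ?_))
      (M.ofReal_exp_le_prod_iterationFactor hO 1 hrun)
    have : 0 ≤ ∑ k, ∑ h : Fin M.H,
        (M.modelError (M.tiltedPolicy 1 (run k).1) (run k).1 h).toReal / 2 :=
      Finset.sum_nonneg fun _ _ => Finset.sum_nonneg fun _ _ =>
        div_nonneg ENNReal.toReal_nonneg (by norm_num)
    linarith
  rw [ENNReal.ofReal_le_one, Real.exp_le_one_iff] at h1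
  linarith

/-- With high probability, the cumulative model error is at most twice
`log (1 / δ)` plus the likelihood regret. -/
theorem one_sub_le_toOuterMeasure_runLaw {F : Set (Model X Y)} {K : ℕ} {Reg : ℝ} {O : M.Oracle}
    (hO : M.IsMLEOracle F K Reg O) (η : ℝ) {δ : ℝ} (hδ : 0 < δ) {s : Set (Fin K → M.Iteration)}
    (hs : ∀ run : Fin K → M.Iteration,
      ∑ k, ∑ h : Fin M.H, M.modelError (M.tiltedPolicy η (run k).1) (run k).1 h ≤
        2 * ENNReal.ofReal (Real.log (1 / δ) + Reg) → run ∈ s) :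
    ENNReal.ofReal (1 - δ) ≤ (M.runLaw η O K).toOuterMeasure s := by
  refine one_sub_le_toOuterMeasure _ _ (M.eexpect_prod_iterationFactor_le_one η O K) hδ
    fun run hrun hW => hs run ?_
  have h1 := (M.ofReal_exp_le_prod_iterationFactor hO η hrun).trans hW
  have hδ' : 0 < 1 / δ := one_div_pos.2 hδ
  rw [ENNReal.ofReal_le_ofReal_iff hδ'.le, ← Real.le_log_iff_exp_le hδ'] at h1
  -- Markov's inequality gives `2 * log (1 / δ) + Reg`; nonnegativity allows the rounder `2 * (log
  -- (1 / δ) + Reg)`.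
  have hReg := M.regret_nonneg hO
  simp only [← Finset.sum_div] at h1
  have hsum : ∑ k, ∑ h : Fin M.H, M.modelError (M.tiltedPolicy η (run k).1) (run k).1 h =
      ENNReal.ofReal (∑ k, ∑ h : Fin M.H,
        (M.modelError (M.tiltedPolicy η (run k).1) (run k).1 h).toReal) := by
    rw [ENNReal.ofReal_sum_of_nonneg fun _ _ =>
      Finset.sum_nonneg fun _ _ => ENNReal.toReal_nonneg]
    refine Finset.sum_congr rfl fun k _ => ?_
    rw [ENNReal.ofReal_sum_of_nonneg fun _ _ => ENNReal.toReal_nonneg]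
    exact Finset.sum_congr rfl fun h _ =>
      (ENNReal.ofReal_toReal (M.modelError_ne_top _ _ _)).symm
  rw [hsum, show (2 : ℝ≥0∞) = ENNReal.ofReal 2 by simp, ← ENNReal.ofReal_mul (by norm_num)]
  exact ENNReal.ofReal_le_ofReal (by linarith)

end Likelihood

end DetMDP

end QSharp

namespace QSharp

/-! ### Moments of Bernoulli laws. -/

section Bernoulli

variable {μ : PMF ℝ} {p : unitInterval}

theorem apply_of_toMeasure_eq_bernoulli
    (hμ : μ.toMeasure = ProbabilityTheory.bernoulliMeasure 1 0 p) (z : ℝ) :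
    (μ z).toReal = if z = 1 then (p : ℝ) else if z = 0 then 1 - (p : ℝ) else 0 := by
  rw [← μ.toMeasure_apply_singleton z (measurableSet_singleton z), hμ,
    ← MeasureTheory.measureReal_def,
    ProbabilityTheory.bernoulliMeasure_real_apply p (measurableSet_singleton z)]
  by_cases h1 : z = 1
  · subst h1
    simp
  · by_cases h0 : z = 0
    · subst h0
      simp
    · simp [h1, h0, Ne.symm h1, Ne.symm h0]

theorem mem_Icc_of_toMeasure_eq_bernoulli
    (hμ : μ.toMeasure = ProbabilityTheory.bernoulliMeasure 1 0 p) {z : ℝ} (hz : z ∈ μ.support) :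
    0 ≤ z ∧ z ≤ 1 := by
  have h := apply_of_toMeasure_eq_bernoulli hμ z
  by_cases h1 : z = 1
  · simp [h1]
  by_cases h0 : z = 0
  · simp [h0]
  rw [if_neg h1, if_neg h0, ENNReal.toReal_eq_zero_iff] at h
  exact absurd h (not_or.2 ⟨hz, μ.apply_ne_top z⟩)

theorem expect_of_toMeasure_eq_bernoulli
    (hμ : μ.toMeasure = ProbabilityTheory.bernoulliMeasure 1 0 p) (f : ℝ → ℝ) :
    expect μ f = p * f 1 + (1 - p) * f 0 := by
  rw [expect, tsum_eq_sum (s := {1, 0}), Finset.sum_pair one_ne_zero,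
    apply_of_toMeasure_eq_bernoulli hμ, apply_of_toMeasure_eq_bernoulli hμ]
  · simp
  · intro z hz
    simp only [Finset.mem_insert, Finset.mem_singleton, not_or] at hz
    rw [apply_of_toMeasure_eq_bernoulli hμ, if_neg hz.1, if_neg hz.2, zero_mul]

theorem variance_of_toMeasure_eq_bernoulli
    (hμ : μ.toMeasure = ProbabilityTheory.bernoulliMeasure 1 0 p) (f : ℝ → ℝ) :
    variance μ f = p * (1 - p) * (f 1 - f 0) ^ 2 := by
  rw [variance, expect_of_toMeasure_eq_bernoulli hμ, expect_of_toMeasure_eq_bernoulli hμ]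
  ring

end Bernoulli

/-! ### The one-step cost of a wrong exponential tilt. -/

section Tilting

/-- For `a ≥ 1 / 2` the logarithm is Lipschitz with constant 2. For smaller `a` the left side is at
most `η * (1 / η) = 1`, while `|a - 1| > 1 / 2`. Thus a ratio as small as `exp (-1 / η)` costs only
a constant. -/
theorem mul_neg_log_le {η a : ℝ} (hη : 0 < η) (hη1 : η ≤ 1) (ha : Real.exp (-(1 / η)) ≤ a) :
    η * -Real.log a ≤ 2 * |a - 1| := by
  have ha0 : 0 < a := (Real.exp_pos _).trans_le ha
  have hlog : -Real.log a ≤ 1 / η := by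
    have := (Real.le_log_iff_exp_le ha0).2 ha
    linarith
  rcases le_or_gt (1 / 2) a with h2 | h2
  · have h3 : -Real.log a ≤ 2 * |a - 1| := by
      have h4 : -Real.log a ≤ a⁻¹ - 1 := by
        rw [← Real.log_inv]
        exact Real.log_le_sub_one_of_pos (inv_pos.2 ha0)
      have h5 : a⁻¹ - 1 = a⁻¹ * (1 - a) := by
        field_simp
      have h6 : a⁻¹ ≤ 2 := by
        rw [inv_le_comm₀ ha0 (by norm_num)]
        linarith
      calc -Real.log a ≤ a⁻¹ * (1 - a) := h5 ▸ h4
        _ ≤ a⁻¹ * |a - 1| := by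
          rw [abs_sub_comm]
          exact mul_le_mul_of_nonneg_left (le_abs_self _) (inv_pos.2 ha0).le
        _ ≤ 2 * |a - 1| := mul_le_mul_of_nonneg_right h6 (abs_nonneg _)
    calc η * -Real.log a ≤ η * (2 * |a - 1|) := mul_le_mul_of_nonneg_left h3 hη.le
      _ ≤ 2 * |a - 1| := mul_le_of_le_one_left (by positivity) hη1
  · calc η * -Real.log a ≤ η * (1 / η) := mul_le_mul_of_nonneg_left hlog hη.le
      _ = 1 := mul_one_div_cancel hη.ne'
      _ ≤ 2 * |a - 1| := by
        rw [abs_sub_comm]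
        linarith [le_abs_self (1 - a)]

variable {Y : Type*} [Fintype Y]

/-- The suboptimality of tilting a distribution `r` by `n` where the optimal tilt is `m`. -/
theorem tilting_gap_le {η : ℝ} (hη : 0 < η) (hη1 : η ≤ 1) {r m n : Y → ℝ} (hr : ∀ y, 0 ≤ r y)
    (hr1 : ∑ y, r y = 1) (hm : ∀ y, 1 ≤ m y ∧ m y ≤ Real.exp (1 / η))
    (hn : ∀ y, 1 ≤ n y ∧ n y ≤ Real.exp (1 / η)) :
    η * Real.log (∑ y, r y * m y) - ∑ y, r y * n y / (∑ y, r y * n y) * (η * Real.log (m y)) +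
      η * ∑ y, r y * n y / (∑ y, r y * n y) *
        Real.log (r y * n y / (∑ y, r y * n y) / r y) ≤
      3 * ∑ y, if r y = 0 then 0 else |n y / m y - 1| := by
  set N := ∑ y, r y * n y with hN
  set S := ∑ y, r y * m y with hS
  have hm0 : ∀ y, 0 < m y := fun y => one_pos.trans_le (hm y).1
  have hn0 : ∀ y, 0 < n y := fun y => one_pos.trans_le (hn y).1
  have hN1 : 1 ≤ N := by
    rw [← hr1]
    exact Finset.sum_le_sum fun y _ => le_mul_of_one_le_right (hr y) (hn y).1
  have hS1 : 1 ≤ S := by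
    rw [← hr1]
    exact Finset.sum_le_sum fun y _ => le_mul_of_one_le_right (hr y) (hm y).1
  have hSE : S ≤ Real.exp (1 / η) := by
    calc S ≤ ∑ y, r y * Real.exp (1 / η) :=
          Finset.sum_le_sum fun y _ => mul_le_mul_of_nonneg_left (hm y).2 (hr y)
      _ = Real.exp (1 / η) := by rw [← Finset.sum_mul, hr1, one_mul]
  have hN0 : 0 < N := one_pos.trans_le hN1
  have hS0 : 0 < S := one_pos.trans_le hS1
  have hsum1 : ∑ y, r y * n y / N = 1 := by rw [← Finset.sum_div, ← hN, div_self hN0.ne']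
  have hterm : ∀ y, r y * n y / N * Real.log (r y * n y / N / r y) =
      r y * n y / N * (Real.log (n y) - Real.log N) := by
    intro y
    rcases (hr y).eq_or_lt with h0 | h0
    · simp [← h0]
    · rw [← Real.log_div (hn0 y).ne' hN0.ne']
      congr 2
      field_simp
  have hdev0 : ∀ y, 0 ≤ if r y = 0 then 0 else |n y / m y - 1| := fun y => by
    split_ifs <;> positivity
  -- `N / S` is the mean of `n / m` under the optimal policy `r * m / S`, whose weights are at most
  -- 1.
  have hNS : |N / S - 1| ≤ ∑ y, if r y = 0 then 0 else |n y / m y - 1| := by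
    have h1 : N / S - 1 = ∑ y, r y * m y / S * (n y / m y - 1) := by
      have h2 : ∀ y, r y * m y / S * (n y / m y - 1) = r y * n y / S - r y * m y / S := fun y => by
        have := (hm0 y).ne'
        field_simp
      simp only [h2, Finset.sum_sub_distrib, ← Finset.sum_div]
      rw [← hN, ← hS, div_self hS0.ne']
    rw [h1]
    refine (Finset.abs_sum_le_sum_abs _ _).trans (Finset.sum_le_sum fun y _ => ?_)
    split_ifs with h0
    · simp [h0]
    · have h3 : 0 ≤ r y * m y := mul_nonneg (hr y) (hm0 y).le
      rw [abs_mul, abs_of_nonneg (div_nonneg h3 hS0.le)]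
      refine mul_le_of_le_one_left (abs_nonneg _) ((div_le_one hS0).2 ?_)
      exact Finset.single_le_sum (f := fun y => r y * m y)
        (fun y _ => mul_nonneg (hr y) (hm0 y).le) (Finset.mem_univ y)
  have hlogNS : η * (Real.log S - Real.log N) ≤ 2 * |N / S - 1| := by
    rw [← neg_sub, ← Real.log_div hN0.ne' hS0.ne']
    refine mul_neg_log_le hη hη1 ?_
    rw [Real.exp_neg, ← one_div]
    exact div_le_div₀ hN0.le hN1 hS0 hSE
  have hlogρ : ∑ y, r y * n y / N * (η * (Real.log (n y) - Real.log (m y))) ≤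
      ∑ y, if r y = 0 then 0 else |n y / m y - 1| := by
    refine Finset.sum_le_sum fun y _ => ?_
    split_ifs with h0
    · simp [h0]
    · have h3 : 0 ≤ r y * n y := mul_nonneg (hr y) (hn0 y).le
      have h4 : Real.log (n y) - Real.log (m y) ≤ |n y / m y - 1| := by
        rw [← Real.log_div (hn0 y).ne' (hm0 y).ne']
        exact (Real.log_le_sub_one_of_pos (div_pos (hn0 y) (hm0 y))).trans (le_abs_self _)
      have h5 : r y * n y / N ≤ 1 := (div_le_one hN0).2
        (Finset.single_le_sum (f := fun y => r y * n y)
          (fun y _ => mul_nonneg (hr y) (hn0 y).le) (Finset.mem_univ y))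
      have h6 : η * (Real.log (n y) - Real.log (m y)) ≤ |n y / m y - 1| :=
        (mul_le_mul_of_nonneg_left h4 hη.le).trans (mul_le_of_le_one_left (abs_nonneg _) hη1)
      exact (mul_le_mul_of_nonneg_left h6 (div_nonneg h3 hN0.le)).trans
        (mul_le_of_le_one_left (abs_nonneg _) h5)
  -- For `ρ = r * n / N` one has `log (ρ / r) = log n - log N`, so the gap is `η log (S / N)` plus
  -- the `ρ`-mean of `η log (n / m)`. The two parts cost 2 and 1 deviation sums.
  have hrw : η * Real.log S - ∑ y, r y * n y / N * (η * Real.log (m y)) +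
      η * ∑ y, r y * n y / N * Real.log (r y * n y / N / r y) =
      η * (Real.log S - Real.log N) +
        ∑ y, r y * n y / N * (η * (Real.log (n y) - Real.log (m y))) := by
    have h1 : ∑ y, r y * n y / N * Real.log N = Real.log N := by
      rw [← Finset.sum_mul, hsum1, one_mul]
    have h2 : ∑ y, r y * n y / N * (Real.log (n y) - Real.log N) =
        ∑ y, r y * n y / N * Real.log (n y) - Real.log N := by
      simp only [mul_sub, Finset.sum_sub_distrib, h1]
    have h3 : ∀ g : Y → ℝ, ∑ y, r y * n y / N * (η * g y) = η * ∑ y, r y * n y / N * g y :=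
      fun g => by
        rw [Finset.mul_sum]
        exact Finset.sum_congr rfl fun y _ => by ring
    simp only [hterm]
    rw [h2, h3, h3]
    simp only [mul_sub, Finset.sum_sub_distrib]
    ring
  rw [hrw]
  linarith

theorem abs_log_ratio_le {η : ℝ} {r n N : ℝ} (hr : 0 < r) (hn : 1 ≤ n ∧ n ≤ Real.exp (1 / η))
    (hN : 1 ≤ N ∧ N ≤ Real.exp (1 / η)) : |Real.log (r * n / N / r)| ≤ 1 / η := by
  have hn0 : 0 < n := one_pos.trans_le hn.1
  have hN0 : 0 < N := one_pos.trans_le hN.1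
  have h : r * n / N / r = n / N := by field_simp
  rw [h, Real.log_div hn0.ne' hN0.ne', abs_le]
  have h1 := Real.log_nonneg hn.1
  have h2 := Real.log_nonneg hN.1
  have h3 := (Real.log_le_iff_le_exp hn0).2 hn.2
  have h4 := (Real.log_le_iff_le_exp hN0).2 hN.2
  constructor <;> linarith

end Tilting

end QSharp

namespace QSharp

namespace DetMDP

/-! ### Soft Bellman equations as exponential moments of the return. -/

section SoftBellman

variable {X Y : Type*} [Fintype Y] (M : DetMDP X Y)

theorem sum_toReal {α : Type*} [Fintype α] (μ : PMF α) : ∑ a, (μ a).toReal = 1 := by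
  rw [← tsum_fintype (L := .unconditional _), tsum_toReal]

theorem expect_fintype {α : Type*} [Fintype α] (μ : PMF α) (f : α → ℝ) :
    expect μ f = ∑ a, (μ a).toReal * f a := by
  rw [expect, tsum_fintype]

theorem sum_toReal_mul_mem {α : Type*} [Fintype α] (μ : PMF α) {f : α → ℝ} {a b : ℝ}
    (hf : ∀ i, a ≤ f i ∧ f i ≤ b) :
    a ≤ ∑ i, (μ i).toReal * f i ∧ ∑ i, (μ i).toReal * f i ≤ b := by
  have hc : ∀ c : ℝ, ∑ i, (μ i).toReal * c = c := fun c => by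
    rw [← Finset.sum_mul, sum_toReal, one_mul]
  constructor
  · rw [← hc a]
    exact Finset.sum_le_sum fun i _ => mul_le_mul_of_nonneg_left (hf i).1 ENNReal.toReal_nonneg
  · rw [← hc b]
    exact Finset.sum_le_sum fun i _ => mul_le_mul_of_nonneg_left (hf i).2 ENNReal.toReal_nonneg

theorem softV_of_lt {η : ℝ} {h : ℕ} (hh : h < M.H) (x : X) :
    M.softV η h x =
      η * Real.log (∑ y, (M.ref h x y).toReal * Real.exp (M.softQ η h x y / η)) := by
  rw [softV, if_pos hh]
  rfl

theorem softV_of_le {η : ℝ} {h : ℕ} (hh : M.H ≤ h) (x : X) : M.softV η h x = 0 := by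
  rw [softV, if_neg hh.not_gt]

theorem exp_softV_of_lt {η : ℝ} (hη : 0 < η) {h : ℕ} (hh : h < M.H) (x : X) :
    Real.exp (M.softV η h x / η) =
      ∑ y, (M.ref h x y).toReal * Real.exp (M.softQ η h x y / η) := by
  rw [M.softV_of_lt hh, mul_div_cancel_left₀ _ hη.ne', Real.exp_log]
  obtain ⟨y, hy⟩ := (M.ref h x).support_nonempty
  refine Finset.sum_pos' (fun y _ => mul_nonneg ENNReal.toReal_nonneg (Real.exp_pos _).le)
    ⟨y, Finset.mem_univ y, mul_pos (ENNReal.toReal_pos hy (PMF.apply_ne_top _ _))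
      (Real.exp_pos _)⟩

/-- Exponentiation cancels the logarithm, and with deterministic transitions both sides satisfy the
same linear backward recursion. -/
theorem ofReal_exp_softV {η : ℝ} (hη : 0 < η) (h : ℕ) (x : X) :
    ENNReal.ofReal (Real.exp (M.softV η h x / η)) =
      eexpect (M.refReturn h x) fun z => ENNReal.ofReal (Real.exp (z / η)) := by
  induction hn : M.H - h generalizing h x with
  | zero =>
    have hh : M.H ≤ h := by omega
    rw [M.softV_of_le hh, refReturn, if_neg hh.not_gt, eexpect_pure]
  | succ n ih =>
    have hh : h < M.H := by omega
    rw [M.exp_softV_of_lt hη hh, refReturn, if_pos hh, eexpect_bind, eexpect, tsum_fintype,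
      ENNReal.ofReal_sum_of_nonneg fun y _ =>
        mul_nonneg ENNReal.toReal_nonneg (Real.exp_pos _).le]
    refine Finset.sum_congr rfl fun y _ => ?_
    rw [ENNReal.ofReal_mul ENNReal.toReal_nonneg, ENNReal.ofReal_toReal (PMF.apply_ne_top _ _),
      eexpect_map, softQ, add_div, Real.exp_add, ENNReal.ofReal_mul (Real.exp_pos _).le,
      ih (h + 1) _ (by omega), ← eexpect_const_mul]
    congr 2
    funext z
    rw [add_div, Real.exp_add, ENNReal.ofReal_mul (Real.exp_pos _).le]

theorem ofReal_exp_softQ {η : ℝ} (hη : 0 < η) (h : ℕ) (x : X) (y : Y) :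
    ENNReal.ofReal (Real.exp (M.softQ η h x y / η)) =
      eexpect (M.Zstar h x y) fun z => ENNReal.ofReal (Real.exp (z / η)) := by
  rw [Zstar, eexpect_map, softQ, add_div, Real.exp_add, ENNReal.ofReal_mul (Real.exp_pos _).le,
    M.ofReal_exp_softV hη, ← eexpect_const_mul]
  congr 1
  funext z
  rw [add_div, Real.exp_add, ENNReal.ofReal_mul (Real.exp_pos _).le]

end SoftBellman

/-! ### Consequences of Bernoulli rewards-to-go. -/

section BernoulliReturns

/-- The rewards-to-go under the reference policy are Bernoulli with means `p`. -/
def HasBernoulliReturns {X Y : Type*} (M : DetMDP X Y) (p : ℕ → X → Y → unitInterval) : Prop :=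
  ∀ h < M.H, ∀ x y,
    (M.Zstar h x y).toMeasure = ProbabilityTheory.bernoulliMeasure 1 0 (p h x y)

variable {X Y : Type*} {M : DetMDP X Y} {p : ℕ → X → Y → unitInterval}

/-- With `E = exp (1 / η)`, `CV² = p(1 - p)(E - 1)² / (pE + 1 - p)²`, and `p(E - 1) ≤ pE + 1 - p`
removes `E`. At `p = 0` the right side is `∞`. -/
theorem ofReal_cv_sq_le (hB : M.HasBernoulliReturns p)
    {η : ℝ} (hη : 0 < η) {h : ℕ} (hh : h < M.H) (x : X) (y : Y) :
    ENNReal.ofReal (M.cv η h x y ^ 2) ≤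
      ENNReal.ofReal (1 - (p h x y : ℝ)) / ENNReal.ofReal (p h x y : ℝ) := by
  have h0 := (p h x y).2.1
  have h1 := (p h x y).2.2
  have hE : 1 ≤ Real.exp (1 / η) := Real.one_le_exp (by positivity)
  rcases h0.eq_or_lt with hp | hp
  · rw [← hp]
    simp
  rw [← ENNReal.ofReal_div_of_pos hp]
  refine ENNReal.ofReal_le_ofReal ?_
  rw [cv, div_pow, Real.sq_sqrt (variance_nonneg _ _),
    variance_of_toMeasure_eq_bernoulli (hB h hh x y),
    expect_of_toMeasure_eq_bernoulli (hB h hh x y), zero_div, Real.exp_zero, mul_one]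
  set q : ℝ := (p h x y : ℝ)
  set E := Real.exp (1 / η)
  have hden : 0 < q * E + (1 - q) := by nlinarith
  rw [div_le_div_iff₀ (by positivity) hp]
  have h2 : q * (E - 1) ≤ q * E + (1 - q) := by linarith
  have h3 : (q * (E - 1)) ^ 2 ≤ (q * E + (1 - q)) ^ 2 :=
    pow_le_pow_left₀ (mul_nonneg h0 (by linarith)) h2 2
  calc q * (1 - q) * (E - 1) ^ 2 * q = (1 - q) * (q * (E - 1)) ^ 2 := by ring
    _ ≤ (1 - q) * (q * E + (1 - q)) ^ 2 := mul_le_mul_of_nonneg_left h3 (by linarith)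

variable [Fintype Y]

theorem exp_softQ_eq_expect (hB : M.HasBernoulliReturns p)
    {η : ℝ} (hη : 0 < η) {h : ℕ} (hh : h < M.H) (x : X) (y : Y) :
    Real.exp (M.softQ η h x y / η) = expect (M.Zstar h x y) fun z => Real.exp (z / η) := by
  have hb : ∀ z ∈ (M.Zstar h x y).support, |Real.exp (z / η)| ≤ Real.exp (1 / η) := fun z hz => by
    rw [Real.abs_exp]
    exact Real.exp_le_exp.2
      (div_le_div_of_nonneg_right (mem_Icc_of_toMeasure_eq_bernoulli (hB h hh x y) hz).2 hη.le)
  have h1 := M.ofReal_exp_softQ hη h x y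
  rw [← ofReal_expect _ (fun z => (Real.exp_pos _).le) hb, ENNReal.ofReal_eq_ofReal_iff
    (Real.exp_pos _).le] at h1
  · exact h1
  · exact tsum_nonneg fun z => mul_nonneg ENNReal.toReal_nonneg (Real.exp_pos _).le

theorem exp_softQ_eq (hB : M.HasBernoulliReturns p)
    {η : ℝ} (hη : 0 < η) {h : ℕ} (hh : h < M.H) (x : X) (y : Y) :
    Real.exp (M.softQ η h x y / η) = p h x y * Real.exp (1 / η) + (1 - p h x y) := by
  rw [exp_softQ_eq_expect hB hη hh, expect_of_toMeasure_eq_bernoulli (hB h hh x y), zero_div,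
    Real.exp_zero, mul_one]

theorem exp_softQ_mem (hB : M.HasBernoulliReturns p)
    {η : ℝ} (hη : 0 < η) {h : ℕ} (hh : h < M.H) (x : X) (y : Y) :
    1 ≤ Real.exp (M.softQ η h x y / η) ∧ Real.exp (M.softQ η h x y / η) ≤ Real.exp (1 / η) := by
  rw [exp_softQ_eq hB hη hh]
  have h1 : 1 ≤ Real.exp (1 / η) := Real.one_le_exp (by positivity)
  have h2 := (p h x y).2.1
  have h3 := (p h x y).2.2
  constructor <;> nlinarith

theorem softQ_mem (hB : M.HasBernoulliReturns p)
    {η : ℝ} (hη : 0 < η) {h : ℕ} (hh : h < M.H) (x : X) (y : Y) :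
    0 ≤ M.softQ η h x y ∧ M.softQ η h x y ≤ 1 := by
  have h1 := exp_softQ_mem hB hη hh x y
  rw [Real.exp_le_exp, Real.one_le_exp_iff, div_le_div_iff_of_pos_right hη] at h1
  exact ⟨by simpa [div_nonneg_iff, hη.le, hη.not_ge] using h1.1, h1.2⟩

theorem softV_mem (hB : M.HasBernoulliReturns p)
    {η : ℝ} (hη : 0 < η) (h : ℕ) (x : X) :
    0 ≤ M.softV η h x ∧ M.softV η h x ≤ 1 := by
  rcases le_or_gt M.H h with hh | hh
  · rw [M.softV_of_le hh]
    exact ⟨le_rfl, zero_le_one⟩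
  have h1 : 1 ≤ Real.exp (M.softV η h x / η) ∧
      Real.exp (M.softV η h x / η) ≤ Real.exp (1 / η) := by
    rw [M.exp_softV_of_lt hη hh]
    exact sum_toReal_mul_mem _ fun y => exp_softQ_mem hB hη hh x y
  rw [Real.exp_le_exp, Real.one_le_exp_iff, div_le_div_iff_of_pos_right hη] at h1
  exact ⟨by simpa [div_nonneg_iff, hη.le, hη.not_ge] using h1.1, h1.2⟩

/-- No bound on rewards is assumed: the reward is a difference of soft values `Q` and `V`, both in
`[0, 1]`. -/
theorem abs_reward_le (hB : M.HasBernoulliReturns p)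
    {η : ℝ} (hη : 0 < η) {h : ℕ} (hh : h < M.H) (x : X) (y : Y) :
    |M.reward h x y| ≤ 1 := by
  have h1 := softQ_mem hB hη hh x y
  have h2 := softV_mem hB hη (h + 1) (M.step h x y)
  rw [softQ] at h1
  rw [abs_le]
  constructor <;> linarith

/-- Because `exp (Q / η) ≥ p * exp (1 / η)`; at `p = 0` the right side is `∞`. -/
theorem ofReal_exp_one_sub_softQ_le (hB : M.HasBernoulliReturns p)
    {η : ℝ} (hη : 0 < η) {h : ℕ} (hh : h < M.H) (x : X) (y : Y) :
    ENNReal.ofReal (Real.exp ((1 - M.softQ η h x y) / η)) ≤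
      1 / ENNReal.ofReal (p h x y : ℝ) := by
  have h0 := (p h x y).2.1
  have h1 := (p h x y).2.2
  rcases h0.eq_or_lt with hp | hp
  · rw [← hp]
    simp
  rw [← ENNReal.ofReal_one, ← ENNReal.ofReal_div_of_pos hp]
  refine ENNReal.ofReal_le_ofReal ?_
  rw [sub_div, Real.exp_sub, div_le_div_iff₀ (Real.exp_pos _) hp, exp_softQ_eq hB hη hh]
  linarith

theorem cvBound_le_bernoulliBound (hB : M.HasBernoulliReturns p)
    [Nonempty Y] {η : ℝ} (hη : 0 < η) (β : ℝ) {K : ℕ}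
    (π : Fin K → Policy X Y) : M.cvBound η β π ≤ M.bernoulliBound p β π := by
  unfold cvBound bernoulliBound envelope linfNorm
  refine mul_le_mul_right (add_le_add (ENNReal.rpow_le_rpow (mul_le_mul_left ?_ _)
    (by norm_num)) (mul_le_mul_left ?_ _)) _
  · refine Finset.sum_le_sum fun h hh => Finset.sum_le_sum fun k _ => ?_
    exact eexpect_mono _ fun xy _ => ofReal_cv_sq_le hB hη (Finset.mem_range.1 hh) _ _
  · refine iSup₂_mono fun h hh => iSup₂_mono fun xy _ => ?_
    exact ofReal_exp_one_sub_softQ_le hB hη (Finset.mem_range.1 hh) _ _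

end BernoulliReturns

/-! ### The learner's policy: explicit form, supports, bounded KL. -/

section TiltedPolicy

variable {X Y : Type*} (M : DetMDP X Y)

/-- The exponential moment `E_{z ∼ Z_h(x,y)} exp(z / η)` of a model. -/
noncomputable def expMoment (η : ℝ) (Z : Model X Y) (h : ℕ) (x : X) (y : Y) : ℝ :=
  expect ((Z h x y).map (Subtype.val : unitInterval → ℝ)) fun z => Real.exp (z / η)

theorem mem_Icc_of_mem_support_map {μ : PMF unitInterval} {z : ℝ}
    (hz : z ∈ (μ.map (Subtype.val : unitInterval → ℝ)).support) : 0 ≤ z ∧ z ≤ 1 := by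
  rw [PMF.mem_support_map_iff] at hz
  obtain ⟨u, -, rfl⟩ := hz
  exact u.2

theorem abs_exp_div_le {η : ℝ} (hη : 0 < η) {z : ℝ} (hz : z ≤ 1) :
    |Real.exp (z / η)| ≤ Real.exp (1 / η) := by
  rw [Real.abs_exp]
  exact Real.exp_le_exp.2 (div_le_div_of_nonneg_right hz hη.le)

theorem ofReal_expMoment {η : ℝ} (hη : 0 < η) (Z : Model X Y) (h : ℕ) (x : X) (y : Y) :
    ENNReal.ofReal (expMoment η Z h x y) =
      eexpect (Z h x y) fun z => ENNReal.ofReal (Real.exp ((z : ℝ) / η)) := by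
  rw [expMoment, ofReal_expect _ (fun z => (Real.exp_pos _).le)
    (fun z hz => abs_exp_div_le hη (mem_Icc_of_mem_support_map hz).2), eexpect_map]

theorem expMoment_mem {η : ℝ} (hη : 0 < η) (Z : Model X Y) (h : ℕ) (x : X) (y : Y) :
    1 ≤ expMoment η Z h x y ∧ expMoment η Z h x y ≤ Real.exp (1 / η) := by
  constructor
  · rw [← ENNReal.one_le_ofReal, ofReal_expMoment hη, ← eexpect_const (Z h x y) 1]
    refine eexpect_mono _ fun z _ => ?_
    rw [ENNReal.one_le_ofReal, Real.one_le_exp_iff]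
    exact div_nonneg z.2.1 hη.le
  · exact (le_abs_self _).trans (abs_expect_le _ fun z hz =>
      abs_exp_div_le hη (mem_Icc_of_mem_support_map hz).2)

theorem tiltedPolicy_toReal [Fintype Y] {η : ℝ} (hη : 0 < η) (Z : Model X Y) (h : ℕ) (x : X)
    (y : Y) :
    (M.tiltedPolicy η Z h x y).toReal =
      (M.ref h x y).toReal * expMoment η Z h x y /
        ∑ y, (M.ref h x y).toReal * expMoment η Z h x y := by
  have hw : ∀ y, (M.tiltWeight η Z h x y).toReal =
      (M.ref h x y).toReal * expMoment η Z h x y := fun y => by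
    rw [tiltWeight, ENNReal.toReal_mul, ← ofReal_expMoment hη,
      ENNReal.toReal_ofReal (zero_le_one.trans (expMoment_mem hη Z h x y).1)]
  have hw' : ∀ y, M.tiltWeight η Z h x y ≠ ∞ := fun y =>
    ENNReal.ne_top_of_tsum_ne_top (M.tsum_tiltWeight_ne_top η Z h x) y
  rw [tiltedPolicy, PMF.normalize_apply, ENNReal.toReal_mul, ENNReal.toReal_inv, hw,
    tsum_fintype, ENNReal.toReal_sum fun y _ => hw' y, div_eq_mul_inv]
  simp only [hw]

theorem support_tiltedPolicy_subset (η : ℝ) (Z : Model X Y) (h : ℕ) (x : X) :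
    (M.tiltedPolicy η Z h x).support ⊆ (M.ref h x).support := by
  intro y hy
  rw [tiltedPolicy, PMF.mem_support_normalize_iff] at hy
  exact left_ne_zero_of_mul hy

/-- Allows the `L_∞(π^ref)` envelope to be used at states visited by the learner. -/
theorem support_stateLaw_subset (η : ℝ) (Z : Model X Y) (h : ℕ) :
    (M.stateLaw (M.tiltedPolicy η Z) h).support ⊆ (M.stateLaw M.ref h).support := by
  induction h with
  | zero => exact subset_rfl
  | succ h ih =>
    intro x hx
    rw [stateLaw, PMF.mem_support_bind_iff] at hx ⊢
    obtain ⟨x', hx', hx⟩ := hx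
    rw [PMF.mem_support_map_iff] at hx
    obtain ⟨y, hy, rfl⟩ := hx
    exact ⟨x', ih hx', (PMF.mem_support_map_iff _ _ _).2
      ⟨y, M.support_tiltedPolicy_subset η Z h x' hy, rfl⟩⟩

/-- On its support the density with respect to the reference policy is a ratio of two numbers in
`[1, exp (1 / η)]`. The bound makes the expectations in the performance difference identity
summable. -/
theorem abs_kl_tiltedPolicy_le [Fintype Y] {η : ℝ} (hη : 0 < η) (Z : Model X Y) (h : ℕ) (x : X) :
    |kl (M.tiltedPolicy η Z h x) (M.ref h x)| ≤ 1 / η := by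
  have hN : 1 ≤ ∑ y, (M.ref h x y).toReal * expMoment η Z h x y ∧
      ∑ y, (M.ref h x y).toReal * expMoment η Z h x y ≤ Real.exp (1 / η) :=
    sum_toReal_mul_mem _ fun y => expMoment_mem hη Z h x y
  rw [kl, ← expect_fintype (M.tiltedPolicy η Z h x) fun y =>
    Real.log ((M.tiltedPolicy η Z h x y).toReal / (M.ref h x y).toReal)]
  refine abs_expect_le _ fun y hy => ?_
  rw [M.tiltedPolicy_toReal hη]
  exact abs_log_ratio_le (ENNReal.toReal_pos (M.support_tiltedPolicy_subset η Z h x hy)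
    (PMF.apply_ne_top _ _)) (expMoment_mem hη Z h x y) hN

end TiltedPolicy

end DetMDP

end QSharp

namespace QSharp

namespace DetMDP

/-! ### Performance difference and the regret bound. -/

section Regret

theorem ofReal_sum_le {ι : Type*} (s : Finset ι) (f : ι → ℝ) :
    ENNReal.ofReal (∑ i ∈ s, f i) ≤ ∑ i ∈ s, ENNReal.ofReal (f i) :=
  Finset.le_sum_of_subadditive _ ENNReal.ofReal_zero.le (fun _ _ => ENNReal.ofReal_add_le) _ _

variable {X Y : Type*} [Fintype Y] {M : DetMDP X Y} {p : ℕ → X → Y → unitInterval}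

/-- The one-step suboptimality of a policy at a state. -/
noncomputable def stepGap (M : DetMDP X Y) (η : ℝ) (π : Policy X Y) (h : ℕ) (x : X) : ℝ :=
  M.softV η h x - expect (π h x) (M.softQ η h x) + η * kl (π h x) (M.ref h x)

theorem abs_expect_softQ_le (hB : M.HasBernoulliReturns p)
    {η : ℝ} (hη : 0 < η) (π : Policy X Y) {h : ℕ} (hh : h < M.H) (x : X) :
    |expect (π h x) (M.softQ η h x)| ≤ 1 :=
  abs_expect_le _ fun y _ => abs_le.2
    ⟨by linarith [(softQ_mem hB hη hh x y).1], (softQ_mem hB hη hh x y).2⟩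

theorem abs_softV_le (hB : M.HasBernoulliReturns p)
    {η : ℝ} (hη : 0 < η) (h : ℕ) (x : X) : |M.softV η h x| ≤ 1 :=
  abs_le.2 ⟨by linarith [(softV_mem hB hη h x).1], (softV_mem hB hη h x).2⟩

theorem abs_stepGap_le (hB : M.HasBernoulliReturns p)
    {η : ℝ} (hη : 0 < η) {π : Policy X Y}
    (hπ : ∀ h x, |kl (π h x) (M.ref h x)| ≤ 1 / η) {h : ℕ} (hh : h < M.H) (x : X) :
    |M.stepGap η π h x| ≤ 3 := by
  have h1 := abs_le.1 (abs_softV_le hB hη h x)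
  have h2 := abs_le.1 (abs_expect_softQ_le hB hη π hh x)
  have h3 : |η * kl (π h x) (M.ref h x)| ≤ 1 := by
    rw [abs_mul, abs_of_pos hη]
    exact (mul_le_mul_of_nonneg_left (hπ h x) hη.le).trans_eq (mul_one_div_cancel hη.ne')
  have h4 := abs_le.1 h3
  rw [stepGap, abs_le]
  constructor <;> linarith

/-- Substituting `r = Q - V` at the next state leaves a difference of consecutive values, which
telescopes over `h`, and the one-step gap. -/
theorem expect_stateActionLaw_eq (hB : M.HasBernoulliReturns p)
    {η : ℝ} (hη : 0 < η) {π : Policy X Y}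
    (hπ : ∀ h x, |kl (π h x) (M.ref h x)| ≤ 1 / η) {h : ℕ} (hh : h < M.H) :
    (expect (M.stateActionLaw π h) fun xy =>
      M.reward h xy.1 xy.2 - η * kl (π h xy.1) (M.ref h xy.1)) =
      expect (M.stateLaw π h) (M.softV η h) - expect (M.stateLaw π (h + 1)) (M.softV η (h + 1)) -
        expect (M.stateLaw π h) (M.stepGap η π h) := by
  have hkl : ∀ x, |η * kl (π h x) (M.ref h x)| ≤ 1 := fun x => by
    rw [abs_mul, abs_of_pos hη]
    exact (mul_le_mul_of_nonneg_left (hπ h x) hη.le).trans_eq (mul_one_div_cancel hη.ne')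
  have hr : ∀ xy : X × Y, |M.reward h xy.1 xy.2 - η * kl (π h xy.1) (M.ref h xy.1)| ≤ 2 :=
    fun xy => (abs_sub _ _).trans
      (by linarith [hkl xy.1, abs_reward_le hB hη hh xy.1 xy.2])
  have hV := abs_softV_le hB hη (M := M)
  rw [stateActionLaw, expect_bind _ _ hr, stateLaw, expect_bind _ _ (hV (h + 1)),
    ← expect_sub _ (B := 1) (C := 1) (fun x _ => hV h x)
      (fun x _ => abs_expect_le _ fun x' _ => hV (h + 1) x'),
    ← expect_sub _ (B := 2) (C := 3)
      (fun x _ => (abs_sub _ _).trans (by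
        have := abs_expect_le ((π h x).map (M.step h x)) fun x' _ => hV (h + 1) x'
        linarith [hV h x]))
      (fun x _ => abs_stepGap_le hB hη hπ hh x)]
  congr 1
  funext x
  rw [expect_map _ _ hr, expect_map _ _ (hV (h + 1)), stepGap,
    expect_sub _ (B := 1) (C := 1) (fun y _ => abs_reward_le hB hη hh x y) (fun y _ => hkl x),
    expect_const]
  have hQ : expect (π h x) (M.softQ η h x) = expect (π h x) (M.reward h x) +
      expect (π h x) fun y => M.softV η (h + 1) (M.step h x y) :=
    expect_add _ (B := 1) (C := 1) (fun y _ => abs_reward_le hB hη hh x y)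
      fun y _ => hV (h + 1) _
  rw [hQ]
  ring

/-- The performance difference identity. -/
theorem optValue_sub_value (hB : M.HasBernoulliReturns p)
    {η : ℝ} (hη : 0 < η) {π : Policy X Y}
    (hπ : ∀ h x, |kl (π h x) (M.ref h x)| ≤ 1 / η) :
    M.optValue η - M.value η π =
      ∑ h ∈ Finset.range M.H, expect (M.stateLaw π h) (M.stepGap η π h) := by
  have h1 : M.value η π = ∑ h ∈ Finset.range M.H,
      (expect (M.stateLaw π h) (M.softV η h) -
        expect (M.stateLaw π (h + 1)) (M.softV η (h + 1)) -
        expect (M.stateLaw π h) (M.stepGap η π h)) :=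
    Finset.sum_congr rfl fun h hh => expect_stateActionLaw_eq hB hη hπ (Finset.mem_range.1 hh)
  have h2 : expect (M.stateLaw π M.H) (M.softV η M.H) = 0 := by
    have : M.softV η M.H = fun _ => 0 := funext fun x => M.softV_of_le le_rfl x
    rw [this, expect_const]
  rw [h1, Finset.sum_sub_distrib, Finset.sum_range_sub' fun h =>
    expect (M.stateLaw π h) (M.softV η h), h2, optValue]
  simp [stateLaw]

theorem stepGap_tiltedPolicy_le (hB : M.HasBernoulliReturns p)
    {η : ℝ} (hη : 0 < η) (hη1 : η ≤ 1) (Z : Model X Y) {h : ℕ}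
    (hh : h < M.H) (x : X) :
    M.stepGap η (M.tiltedPolicy η Z) h x ≤
      3 * ∑ y, if (M.ref h x y).toReal = 0 then 0 else
        |expMoment η Z h x y / Real.exp (M.softQ η h x y / η) - 1| := by
  refine le_of_eq_of_le ?_ (tilting_gap_le hη hη1 (r := fun y => (M.ref h x y).toReal)
    (m := fun y => Real.exp (M.softQ η h x y / η)) (n := expMoment η Z h x)
    (fun y => ENNReal.toReal_nonneg) (sum_toReal _) (exp_softQ_mem hB hη hh x)
    (expMoment_mem hη Z h x))
  rw [stepGap, M.softV_of_lt hh, expect_fintype, kl]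
  simp only [M.tiltedPolicy_toReal hη, Real.log_exp, mul_div_cancel₀ _ hη.ne']

/-- The change-of-mean bound with `B = exp (1 / η)`, divided by `exp (Q / η)`: the standard
deviation becomes CV and `B` becomes the envelope integrand. -/
theorem ofReal_abs_expMoment_ratio_sub_one_le (hB : M.HasBernoulliReturns p)
    {η : ℝ} (hη : 0 < η) (Z : Model X Y) {h : ℕ}
    (hh : h < M.H) (x : X) (y : Y) :
    ENNReal.ofReal |expMoment η Z h x y / Real.exp (M.softQ η h x y / η) - 1| ≤
      2 * (ENNReal.ofReal (M.cv η h x y) * hellingerSq (M.Zstar h x y)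
        ((Z h x y).map (Subtype.val : unitInterval → ℝ)) ^ (1 / 2 : ℝ)) +
      ENNReal.ofReal (Real.exp ((1 - M.softQ η h x y) / η)) * hellingerSq (M.Zstar h x y)
        ((Z h x y).map (Subtype.val : unitInterval → ℝ)) := by
  have hle : ∀ z : ℝ, z ≤ 1 → Real.exp (z / η) ≤ Real.exp (1 / η) := fun z hz =>
    Real.exp_le_exp.2 (div_le_div_of_nonneg_right hz hη.le)
  have key := ofReal_abs_expect_sub_le (M.Zstar h x y)
    ((Z h x y).map (Subtype.val : unitInterval → ℝ)) (f := fun z => Real.exp (z / η))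
    (B := Real.exp (1 / η)) (fun z => (Real.exp_pos _).le)
    (fun z hz => hle z (mem_Icc_of_toMeasure_eq_bernoulli (hB h hh x y) hz).2)
    (fun z hz => hle z (mem_Icc_of_mem_support_map hz).2)
  rw [← exp_softQ_eq_expect hB hη hh] at key
  set m := Real.exp (M.softQ η h x y / η) with hm
  have hm0 : 0 < m := Real.exp_pos _
  have h1 : |expMoment η Z h x y / m - 1| = |expMoment η Z h x y - m| * m⁻¹ := by
    rw [div_sub_one hm0.ne', abs_div, abs_of_pos hm0, div_eq_mul_inv]
  rw [h1, ENNReal.ofReal_mul (abs_nonneg _), cv, ← exp_softQ_eq_expect hB hη hh, ← hm, sub_div,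
    Real.exp_sub, ← hm, div_eq_mul_inv (√_) m, div_eq_mul_inv (Real.exp (1 / η)) m,
    ENNReal.ofReal_mul (Real.sqrt_nonneg _), ENNReal.ofReal_mul (Real.exp_pos _).le]
  refine (mul_le_mul_left key _).trans_eq ?_
  ring

theorem ofReal_expect_stepGap_le (hB : M.HasBernoulliReturns p)
    [Nonempty Y] {η : ℝ} (hη : 0 < η) (hη1 : η ≤ 1) (Z : Model X Y)
    {h : ℕ} (hh : h < M.H) :
    ENNReal.ofReal (expect (M.stateLaw (M.tiltedPolicy η Z) h)
      (M.stepGap η (M.tiltedPolicy η Z) h)) ≤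
      3 * Fintype.card Y * (2 * (eexpect (M.rollInUnifLaw (M.tiltedPolicy η Z) h) fun xy =>
        ENNReal.ofReal (M.cv η h xy.1 xy.2) * hellingerSq (M.Zstar h xy.1 xy.2)
          ((Z h xy.1 xy.2).map (Subtype.val : unitInterval → ℝ)) ^ (1 / 2 : ℝ)) +
        M.envelope η h * M.modelError (M.tiltedPolicy η Z) Z h) := by
  refine (ofReal_expect_le _ fun x _ =>
    abs_stepGap_le hB hη (M.abs_kl_tiltedPolicy_le hη Z) hh x).trans ?_
  rw [modelError, ← eexpect_const_mul, ← eexpect_const_mul, ← eexpect_add, ← eexpect_const_mul,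
    rollInUnifLaw, eexpect_bind]
  refine eexpect_mono _ fun x hx => ?_
  rw [eexpect_map, eexpect_const_mul, eexpect, tsum_fintype]
  -- The factor `A` enters here: a sum over actions is `A` times the mean over a uniform action.
  have hA : ∀ g : Y → ℝ≥0∞, 3 * (Fintype.card Y : ℝ≥0∞) *
      ∑ y, PMF.uniformOfFintype Y y * g y = 3 * ∑ y, g y := fun g => by
    simp only [PMF.uniformOfFintype_apply]
    rw [← Finset.mul_sum, mul_assoc, ← mul_assoc (Fintype.card Y : ℝ≥0∞),
      ENNReal.mul_inv_cancel (by simp) (by simp), one_mul]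
  rw [hA]
  refine (ENNReal.ofReal_le_ofReal (stepGap_tiltedPolicy_le hB hη hη1 Z hh x)).trans ?_
  rw [ENNReal.ofReal_mul (by norm_num), ENNReal.ofReal_ofNat,
    ENNReal.ofReal_sum_of_nonneg fun y _ => by split_ifs <;> positivity]
  refine mul_le_mul_right (Finset.sum_le_sum fun y _ => ?_) _
  split_ifs with h0
  · simp
  refine (ofReal_abs_expMoment_ratio_sub_one_le hB hη Z hh x y).trans ?_
  refine add_le_add le_rfl (mul_le_mul_left ?_ _)
  -- The case `r y = 0` has been split off, so only pairs reachable under the reference policy need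
  -- the envelope.
  have hmem : (x, y) ∈ (M.stateActionLaw M.ref h).support := by
    rw [stateActionLaw, PMF.mem_support_bind_iff]
    refine ⟨x, M.support_stateLaw_subset η Z h hx, ?_⟩
    rw [PMF.mem_support_map_iff]
    exact ⟨y, fun hy => h0 (by rw [hy, ENNReal.toReal_zero]), rfl⟩
  exact le_iSup₂ (f := fun (xy : X × Y) (_ : xy ∈ (M.stateActionLaw M.ref h).support) =>
    ENNReal.ofReal (Real.exp ((1 - M.softQ η h xy.1 xy.2) / η))) (x, y) hmem

/-- A single Cauchy-Schwarz over all `(k, h, x, y)` keeps the sums under the square root. -/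
theorem sum_eexpect_cv_mul_le [Nonempty Y] (η : ℝ) {K : ℕ} (π : Fin K → Policy X Y)
    (Z : Fin K → Model X Y) :
    ∑ k, ∑ h : Fin M.H, (eexpect (M.rollInUnifLaw (π k) h) fun xy =>
        ENNReal.ofReal (M.cv η h xy.1 xy.2) * hellingerSq (M.Zstar h xy.1 xy.2)
          ((Z k h xy.1 xy.2).map (Subtype.val : unitInterval → ℝ)) ^ (1 / 2 : ℝ)) ≤
      (∑ h ∈ Finset.range M.H, ∑ k, eexpect (M.rollInUnifLaw (π k) h) fun xy =>
        ENNReal.ofReal (M.cv η h xy.1 xy.2 ^ 2)) ^ (1 / 2 : ℝ) *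
      (∑ k, ∑ h : Fin M.H, M.modelError (π k) (Z k) h) ^ (1 / 2 : ℝ) := by
  have key := tsum_mul_mul_le_rpow (ι := Fin K × Fin M.H × X × Y)
    (fun i => M.rollInUnifLaw (π i.1) i.2.1 i.2.2)
    (fun i => ENNReal.ofReal (M.cv η i.2.1 i.2.2.1 i.2.2.2))
    (fun i => hellingerSq (M.Zstar i.2.1 i.2.2.1 i.2.2.2)
      ((Z i.1 i.2.1 i.2.2.1 i.2.2.2).map (Subtype.val : unitInterval → ℝ)) ^ (1 / 2 : ℝ))
  have hcv : ∀ (h : ℕ) (x : X) (y : Y), 0 ≤ M.cv η h x y := fun h x y =>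
    div_nonneg (Real.sqrt_nonneg _)
      (tsum_nonneg fun z => mul_nonneg ENNReal.toReal_nonneg (Real.exp_pos _).le)
  have hsq : ∀ a : ℝ≥0∞, (a ^ (1 / 2 : ℝ)) ^ 2 = a := fun a => by
    rw [← ENNReal.rpow_two, ← ENNReal.rpow_mul]
    norm_num
  have hprod : ∀ F : Fin K × Fin M.H × X × Y → ℝ≥0∞,
      ∑' i, F i = ∑ k, ∑ h, ∑' xy, F (k, h, xy) := fun F => by
    rw [ENNReal.tsum_prod', tsum_fintype]
    refine Finset.sum_congr rfl fun k _ => ?_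
    rw [ENNReal.tsum_prod', tsum_fintype]
  simp only [hprod, hsq, ← ENNReal.ofReal_pow (hcv _ _ _)] at key
  rw [Finset.sum_range, Finset.sum_comm (s := (Finset.univ : Finset (Fin M.H)))]
  exact key

/-- The regret of the tilted policies, bounded by the model errors. -/
theorem ofReal_sum_regret_le (hB : M.HasBernoulliReturns p)
    [Nonempty Y] {η : ℝ} (hη : 0 < η) (hη1 : η ≤ 1) {β : ℝ} {K : ℕ}
    (Z : Fin K → Model X Y)
    (hZ : ∑ k, ∑ h : Fin M.H, M.modelError (M.tiltedPolicy η (Z k)) (Z k) h ≤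
      2 * ENNReal.ofReal β) :
    ENNReal.ofReal (∑ k, (M.optValue η - M.value η (M.tiltedPolicy η (Z k)))) ≤
      12 * M.cvBound η β fun k => M.tiltedPolicy η (Z k) := by
  set E := ⨆ h ∈ Finset.range M.H, M.envelope η h with hE
  set V := ∑ h ∈ Finset.range M.H, ∑ k, eexpect (M.rollInUnifLaw (M.tiltedPolicy η (Z k)) h)
    fun xy => ENNReal.ofReal (M.cv η h xy.1 xy.2 ^ 2) with hV
  have hrpow : (2 * ENNReal.ofReal β) ^ (1 / 2 : ℝ) ≤ 2 * ENNReal.ofReal β ^ (1 / 2 : ℝ) := by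
    rw [ENNReal.mul_rpow_of_nonneg _ _ (by norm_num)]
    refine mul_le_mul_left ?_ _
    calc (2 : ℝ≥0∞) ^ (1 / 2 : ℝ) ≤ 2 ^ (1 : ℝ) :=
          ENNReal.rpow_le_rpow_of_exponent_le (by norm_num) (by norm_num)
      _ = 2 := ENNReal.rpow_one 2
  calc ENNReal.ofReal (∑ k, (M.optValue η - M.value η (M.tiltedPolicy η (Z k))))
      = ENNReal.ofReal (∑ k, ∑ h : Fin M.H, expect (M.stateLaw (M.tiltedPolicy η (Z k)) h)
          (M.stepGap η (M.tiltedPolicy η (Z k)) h)) := by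
        congr 1
        refine Finset.sum_congr rfl fun k _ => ?_
        rw [optValue_sub_value hB hη (M.abs_kl_tiltedPolicy_le hη (Z k)), Finset.sum_range]
    _ ≤ ∑ k, ∑ h : Fin M.H, ENNReal.ofReal (expect (M.stateLaw (M.tiltedPolicy η (Z k)) h)
          (M.stepGap η (M.tiltedPolicy η (Z k)) h)) :=
        (ofReal_sum_le _ _).trans
          (Finset.sum_le_sum fun k _ => ofReal_sum_le _ _)
    _ ≤ ∑ k, ∑ h : Fin M.H, 3 * Fintype.card Y *
          (2 * (eexpect (M.rollInUnifLaw (M.tiltedPolicy η (Z k)) h) fun xy =>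
            ENNReal.ofReal (M.cv η h xy.1 xy.2) * hellingerSq (M.Zstar h xy.1 xy.2)
              ((Z k h xy.1 xy.2).map (Subtype.val : unitInterval → ℝ)) ^ (1 / 2 : ℝ)) +
            E * M.modelError (M.tiltedPolicy η (Z k)) (Z k) h) := by
        refine Finset.sum_le_sum fun k _ => Finset.sum_le_sum fun h _ => ?_
        refine (ofReal_expect_stepGap_le hB hη hη1 (Z k) h.2).trans ?_
        refine mul_le_mul_right (add_le_add le_rfl (mul_le_mul_left ?_ _)) _
        exact le_iSup₂ (f := fun (h : ℕ) (_ : h ∈ Finset.range M.H) => M.envelope η h) (h : ℕ)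
          (Finset.mem_range.2 h.2)
    _ = 3 * Fintype.card Y *
          (2 * (∑ k, ∑ h : Fin M.H, eexpect (M.rollInUnifLaw (M.tiltedPolicy η (Z k)) h) fun xy =>
            ENNReal.ofReal (M.cv η h xy.1 xy.2) * hellingerSq (M.Zstar h xy.1 xy.2)
              ((Z k h xy.1 xy.2).map (Subtype.val : unitInterval → ℝ)) ^ (1 / 2 : ℝ)) +
            E * ∑ k, ∑ h : Fin M.H, M.modelError (M.tiltedPolicy η (Z k)) (Z k) h) := by
        simp only [← Finset.mul_sum, Finset.sum_add_distrib]
    _ ≤ 3 * Fintype.card Y * (2 * (V ^ (1 / 2 : ℝ) * (2 * ENNReal.ofReal β ^ (1 / 2 : ℝ))) +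
          E * (2 * ENNReal.ofReal β)) := by
        refine mul_le_mul_right (add_le_add (mul_le_mul_right ?_ _) (mul_le_mul_right hZ _)) _
        refine (sum_eexpect_cv_mul_le η _ Z).trans (mul_le_mul_right ?_ _)
        exact (ENNReal.rpow_le_rpow hZ (by norm_num)).trans hrpow
    -- The constants are `3 * 2 * 2`, with `√2` rounded up to 2, and `3 * 2`.
    _ = 12 * (Fintype.card Y * (V ^ (1 / 2 : ℝ) * ENNReal.ofReal β ^ (1 / 2 : ℝ))) +
          6 * (Fintype.card Y * (E * ENNReal.ofReal β)) := by ring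
    _ ≤ 12 * (Fintype.card Y * (V ^ (1 / 2 : ℝ) * ENNReal.ofReal β ^ (1 / 2 : ℝ))) +
          12 * (Fintype.card Y * (E * ENNReal.ofReal β)) :=
        add_le_add le_rfl (mul_le_mul_left (by norm_num) _)
    _ = 12 * M.cvBound η β fun k => M.tiltedPolicy η (Z k) := by
        rw [cvBound, ← hE, ← hV, ENNReal.mul_rpow_of_nonneg _ _ (by norm_num)]
        ring

end Regret

end DetMDP

end QSharp

/-! ### The main theorem. -/

theorem mainTheorem4 :
    ∃ C : ℝ≥0, ∀ (X : Type*) (Y : Type*) [Fintype Y] [Nonempty Y]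
      (M : QSharp.DetMDP X Y) (p : ℕ → X → Y → unitInterval)
      (F : Set (QSharp.Model X Y)) (K : ℕ) (Reg : ℝ) (O : M.Oracle) (η δ : ℝ),
      (∀ h < M.H, ∀ x y,
        (M.Zstar h x y).toMeasure = ProbabilityTheory.bernoulliMeasure 1 0 (p h x y)) →
      M.Realizable F →
      M.IsMLEOracle F K Reg O →
      0 < η → η ≤ 1 → 0 < δ → δ < 1 →
      ENNReal.ofReal (1 - δ) ≤ (M.runLaw η O K).toOuterMeasure
        {run : Fin K → M.Iteration |
          ENNReal.ofReal (∑ k, (M.optValue η - M.value η (M.tiltedPolicy η (run k).1))) ≤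
              C * M.cvBound η (Real.log (1 / δ) + Reg) (fun k => M.tiltedPolicy η (run k).1) ∧
          C * M.cvBound η (Real.log (1 / δ) + Reg) (fun k => M.tiltedPolicy η (run k).1) ≤
              C * M.bernoulliBound p (Real.log (1 / δ) + Reg)
                (fun k => M.tiltedPolicy η (run k).1)} := by
  refine ⟨12, fun X Y _ _ M p F K Reg O η δ hB _ hO hη hη1 hδ _ => ?_⟩
  -- Only the first inequality needs the high-probability event; the second holds for every run.
  refine M.one_sub_le_toOuterMeasure_runLaw hO η hδ fun run hrun => ⟨?_, ?_⟩
  · exact QSharp.DetMDP.ofReal_sum_regret_le hB hη hη1 (fun k => (run k).1) hrun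
  · exact mul_le_mul_right (QSharp.DetMDP.cvBound_le_bernoulliBound hB hη _ _) _
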